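/- Let $A\in\mathbb R^{n_x\times n_x}$, $B\in\mathbb R^{n_x\times p}$, $\hat B\in\mathbb R^{n_x\times q}$, $C\in\mathbb R^{m\times n_x}$, $D\in\mathbb R^{m\times p}$, let $\lambda\in[0,\infty]$, and let $T_{\mathrm{desired}}$ be an $m\times q$ matrix function analytic on $|z|>1$. Let $\frac1z\mathcal{RH}_\infty$ denote the real rational, strictly proper transfer matrices all of whose poles lie in the open unit disk. For $\Phi_x,\Phi_u$ put $T=C\Phi_x\hat B+D\Phi_u\hat B-T_{\mathrm{desired}}$ and $$J(\Phi_x,\Phi_u)=\|T\|_{\mathcal H_2}+\lambda\|T\|_{\mathcal H_\infty},$$ where the norms are the Hardy norms on the exterior of the unit disk (Frobenius norm in $\mathcal H_2$, spectral norm in $\mathcal H_\infty$), and where $\lambda=\infty$ means $J=\|T\|_{\mathcal H_\infty}$. Let $J^*$ be the infimum of $J$ over all $\Phi_x,\Phi_u\in\frac1z\mathcal{RH}_\infty$ with $(zI-A)\Phi_x(z)-B\Phi_u(z)=I$. Assume that this infimum is attained and that $0<J^*<\infty$. Let $\sigma$ be the set of eigenvalues of $A$ and $m_s$ the algebraic multiplicity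 of $s\in\sigma$. For a finite subset $P$ of the open unit disk, let $J(P)$ be the infimum of $J$ over the pairs of the form $$\Phi_u(z)=\sum_{s\in P}\frac{H_s}{z-s},\qquad \Phi_x(z)=\sum_{s\in P\setminus\sigma}\frac{G_s}{z-s}+\sum_{s\in\sigma}\sum_{i=1}^{m_s+1}\frac{G_{(s,i)}}{(z-s)^i}$$ in $\frac1z\mathcal{RH}_\infty$ whose coefficient matrices satisfy, with $\tilde m_s=1$ if $s\in P$ and $\tilde m_s=0$ otherwise, $$\begin{aligned} &G_{(s,2)}+(sI-A)G_{(s,1)}-BH_s=0 && (s\in\sigma\cap P),\\ &(sI-A)G_s-BH_s=0 && (s\in P\setminus\sigma),\\ &G_{(s,i+1)}+(sI-A)G_{(s,i)}=0 && (s\in\sigma,\ 1+\tilde m_s\le i\le m_s),\\ &(sI-A)G_{(s,m_s+\tilde m_s)}=0 && (s\in\sigma),\\ &\textstyle\sum_{s\in P\setminus\sigma}G_s+\sum_{s\in\sigma}G_{(s,1)}=I. \end{aligned}$$ These equations express $(zI-A)\Phi_x-B\Phi_u=I$. For integers $n\ge1$ let $P_n$ consist of the points $\sqrt{k/n}\,e^{2i\sqrt{\pi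 k}}$, $1\le k\le n-1$, of an Archimedes spiral, together with their complex conjugates. Then there are constants $\hat K>0$ and $N>0$, depending only on the problem data and on an optimal solution $(\Phi_x^*,\Phi_u^*)$ and not on $n$, such that for all $n\ge N$ one has $|P_n|+2=2n$, the value $J(P_n)$ is finite, and $$\frac{J(P_n)-J^*}{J^*}\le\frac{\hat K}{\sqrt n}.$$ In particular the relative suboptimality is of order $(|P_n|+2)^{-1/2}$. -/

import Mathlib

open scoped ENNReal

noncomputable section

/-- A real matrix regarded as a complex one. -/
def cplx {a b : ℕ} (M : Matrix (Fin a) (Fin b) ℝ) : Matrix (Fin a) (Fin b) ℂ :=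
  M.map (fun x : ℝ => (x : ℂ))

/-- A real matrix regarded as a constant transfer matrix. -/
def constTF {a b : ℕ} (M : Matrix (Fin a) (Fin b) ℝ) : Matrix (Fin a) (Fin b) (RatFunc ℝ) :=
  M.map (fun x : ℝ => RatFunc.C x)

/-- Entrywise evaluation of a real rational transfer matrix at a complex point. -/
def evalTF {a b : ℕ} (Φ : Matrix (Fin a) (Fin b) (RatFunc ℝ)) (z : ℂ) :
    Matrix (Fin a) (Fin b) ℂ :=
  Φ.map (fun f : RatFunc ℝ => RatFunc.eval (algebraMap ℝ ℂ) z f)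

/-- Real rational, strictly proper and stable transfer matrices: the set `(1/z) RH_∞`.
`num` and `denom` of a `RatFunc` are coprime, so the roots of `denom` are exactly the poles. -/
def IsStrictlyProperStable {a b : ℕ} (Φ : Matrix (Fin a) (Fin b) (RatFunc ℝ)) : Prop :=
  ∀ i j, (Φ i j).num.degree < (Φ i j).denom.degree ∧
    ∀ z : ℂ, Polynomial.aeval z (Φ i j).denom = 0 → ‖z‖ < 1

/-- The squared Frobenius norm of a complex matrix. -/
def frobSq {a b : ℕ} (M : Matrix (Fin a) (Fin b) ℂ) : ℝ≥0∞ :=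
  ∑ i, ∑ j, ‖M i j‖ₑ ^ 2

/-- The Hardy `H₂` norm on the exterior of the closed unit disk. -/
def normH2 {a b : ℕ} (T : ℂ → Matrix (Fin a) (Fin b) ℂ) : ℝ≥0∞ :=
  ⨆ (r : ℝ) (_ : 1 < r),
    (ENNReal.ofReal (1 / (2 * Real.pi)) *
      ∫⁻ θ in Set.Ioc (0 : ℝ) (2 * Real.pi),
        frobSq (T ((r : ℂ) * Complex.exp ((θ : ℂ) * Complex.I)))) ^ (1 / 2 : ℝ)

section
open scoped Matrix.Norms.L2Operator

/-- The Hardy `H_∞` norm on the exterior of the closed unit disk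
(`‖T z‖ₑ` is the spectral norm, i.e. the `ℓ²` operator norm, of the matrix `T z`). -/
def normHinf {a b : ℕ} (T : ℂ → Matrix (Fin a) (Fin b) ℂ) : ℝ≥0∞ :=
  ⨆ (z : ℂ) (_ : 1 < ‖z‖), ‖T z‖ₑ

end

/-- The mixed objective with weight `lam ∈ [0, ∞]`; `lam = 0` is the pure `H₂` objective and
`lam = ∞` is the pure `H_∞` objective. -/
def mixedNorm {a b : ℕ} (lam : ℝ≥0∞) (T : ℂ → Matrix (Fin a) (Fin b) ℂ) : ℝ≥0∞ :=
  if lam = ⊤ then normHinf T else normH2 T + lam * normHinf T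

/-- The data of the state-feedback control design problem: the system
`x(k+1) = A x(k) + B u(k) + Bhat w(k)`, `y(k) = C x(k) + D u(k)`, the desired closed-loop transfer
function `Tdes` and the weight `lam`. -/
structure ControlProblem (n p q m : ℕ) where
  A : Matrix (Fin n) (Fin n) ℝ
  B : Matrix (Fin n) (Fin p) ℝ
  Bhat : Matrix (Fin n) (Fin q) ℝ
  C : Matrix (Fin m) (Fin n) ℝ
  D : Matrix (Fin m) (Fin p) ℝ
  Tdes : ℂ → Matrix (Fin m) (Fin q) ℂ
  lam : ℝ≥0∞

namespace ControlProblem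

variable {n p q m : ℕ} (S : ControlProblem n p q m)

/-- The objective value of a pair of closed-loop responses, as functions on `|z| > 1`. -/
def cost (Φx : ℂ → Matrix (Fin n) (Fin n) ℂ) (Φu : ℂ → Matrix (Fin p) (Fin n) ℂ) : ℝ≥0∞ :=
  mixedNorm S.lam (fun z =>
    cplx S.C * Φx z * cplx S.Bhat + cplx S.D * Φu z * cplx S.Bhat - S.Tdes z)

/-- Feasibility for the infinite-dimensional system level synthesis problem:
`(zI - A) Φx - B Φu = I` and `Φx, Φu ∈ (1/z) RH_∞`. -/
def Feasible (Φx : Matrix (Fin n) (Fin n) (RatFunc ℝ))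
    (Φu : Matrix (Fin p) (Fin n) (RatFunc ℝ)) : Prop :=
  (Matrix.scalar (Fin n) (RatFunc.X : RatFunc ℝ) - constTF S.A) * Φx - constTF S.B * Φu = 1 ∧
    IsStrictlyProperStable Φx ∧ IsStrictlyProperStable Φu

/-- The ground-truth optimal cost `J*`. -/
def Jstar : ℝ≥0∞ :=
  ⨅ (Φx : Matrix (Fin n) (Fin n) (RatFunc ℝ)) (Φu : Matrix (Fin p) (Fin n) (RatFunc ℝ))
    (_ : S.Feasible Φx Φu), S.cost (evalTF Φx) (evalTF Φu)

/-- `(Φx, Φu)` is an optimal solution of the infinite-dimensional problem. -/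
def IsOptimal (Φx : Matrix (Fin n) (Fin n) (RatFunc ℝ))
    (Φu : Matrix (Fin p) (Fin n) (RatFunc ℝ)) : Prop :=
  S.Feasible Φx Φu ∧ S.cost (evalTF Φx) (evalTF Φu) = S.Jstar

/-- The plant poles `σ`: the eigenvalues of `A`. -/
def plantPoles : Finset ℂ := (cplx S.A).charpoly.roots.toFinset

/-- The (algebraic) multiplicity `m_q` of a plant pole. -/
def mult (z : ℂ) : ℕ := (cplx S.A).charpoly.rootMultiplicity z

end ControlProblem

/-- Coefficient matrices of a simple pole approximation: `H z` and `G z` are the coefficients at a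
selected pole `z`, and `Gσ z i` is the coefficient of `1 / (ζ - z)^i` at a plant pole `z`. -/
structure SPACoeffs (n p : ℕ) where
  H : ℂ → Matrix (Fin p) (Fin n) ℂ
  G : ℂ → Matrix (Fin n) (Fin n) ℂ
  Gσ : ℂ → ℕ → Matrix (Fin n) (Fin n) ℂ

namespace ControlProblem

variable {n p q m : ℕ} (S : ControlProblem n p q m) (P : Finset ℂ) (c : SPACoeffs n p)

/-- `Φu(z) = ∑_{p ∈ P} H_p / (z - p)`. -/
def spaU (z : ℂ) : Matrix (Fin p) (Fin n) ℂ :=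
  ∑ s ∈ P, (z - s)⁻¹ • c.H s

/-- `Φx(z) = ∑_{p ∈ P - σ} G_p / (z - p) + ∑_{q ∈ σ} ∑_{i=1}^{m_q+1} G_{(q,i)} / (z - q)^i`. -/
def spaX (z : ℂ) : Matrix (Fin n) (Fin n) ℂ :=
  ∑ s ∈ P \ S.plantPoles, (z - s)⁻¹ • c.G s +
    ∑ s ∈ S.plantPoles, ∑ i ∈ Finset.Icc 1 (S.mult s + 1), ((z - s) ^ i)⁻¹ • c.Gσ s i

/-- `m̃_q`: it is `1` if `q ∈ P` and `0` otherwise. -/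
def mtilde (z : ℂ) : ℕ := if z ∈ P then 1 else 0

/-- `zI - A` at a complex number `z`. -/
def shift (z : ℂ) : Matrix (Fin n) (Fin n) ℂ := Matrix.scalar (Fin n) z - cplx S.A

/-- Feasibility of the coefficients of a simple pole approximation with poles `P`: the affine
system level synthesis constraints, together with `Φx ∈ (1/z) RH_∞` and `Φu ∈ (1/z) RH_∞`, which
for functions of this form with `P` inside the open unit disk means that the coefficients at plant
poles outside the open unit disk vanish and that the transfer functions are real. -/
structure SPAFeasible : Prop where
  sls_common : ∀ s ∈ S.plantPoles ∩ P,
    c.Gσ s 2 + S.shift s * c.Gσ s 1 - cplx S.B * c.H s = 0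
  sls_simple : ∀ s ∈ P \ S.plantPoles, S.shift s * c.G s - cplx S.B * c.H s = 0
  sls_chain : ∀ s ∈ S.plantPoles, ∀ i ∈ Finset.Icc (1 + mtilde P s) (S.mult s),
    c.Gσ s (i + 1) + S.shift s * c.Gσ s i = 0
  sls_last : ∀ s ∈ S.plantPoles, S.shift s * c.Gσ s (S.mult s + mtilde P s) = 0
  sls_sum : ∑ s ∈ P \ S.plantPoles, c.G s + ∑ s ∈ S.plantPoles, c.Gσ s 1 = 1
  stable : ∀ s ∈ S.plantPoles, 1 ≤ ‖s‖ → ∀ i ∈ Finset.Icc 1 (S.mult s + 1), c.Gσ s i = 0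
  real_u : ∀ z : ℂ, 1 < ‖z‖ →
    spaU P c (starRingEnd ℂ z) = (spaU P c z).map (starRingEnd ℂ)
  real_x : ∀ z : ℂ, 1 < ‖z‖ →
    S.spaX P c (starRingEnd ℂ z) = (S.spaX P c z).map (starRingEnd ℂ)

/-- The optimal cost `J(P)` of the simple pole approximation control design with poles `P`
(it is `∞` if that design problem is infeasible). -/
def Jspa : ℝ≥0∞ :=
  ⨅ (c : SPACoeffs n p) (_ : S.SPAFeasible P c), S.cost (S.spaX P c) (spaU P c)

end ControlProblem

/-- The `k`-th point `√(k/n) · exp(2 i √(π k))` of the Archimedes spiral. -/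
def spiralPole (n k : ℕ) : ℂ :=
  (Real.sqrt ((k : ℝ) / (n : ℝ)) : ℂ) *
    Complex.exp (((2 * Real.sqrt (Real.pi * (k : ℝ)) : ℝ) : ℂ) * Complex.I)

/-- The spiral pole selection `P_n`: the spiral points `k = 1, …, n - 1` and their conjugates. -/
def spiralPoles (n : ℕ) : Finset ℂ :=
  (Finset.Ico 1 n).image (spiralPole n) ∪
    (Finset.Ico 1 n).image (fun k => starRingEnd ℂ (spiralPole n k))

end

/-!
Write an optimal pair as `Φx = M / d`, `Φu = N / d` with `d` a real polynomial that is a product of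
conjugate pairs of linear factors, with roots `r` in the open disk. Consecutive turns of the spiral
are `√π / √n` apart, and so are, up to constants, neighbouring points on it; hence each root can be
moved by `O(1 / √n)` onto its own spiral point, and `d` becomes `d'`.

The constraint `(zI - A) Φx - B Φu = I` has to be restored without creating unstable poles. Split
`det (zI - A) = a₁ a₂`, where `a₁` divides a power of `d` and `a₂` is coprime to `d`. All roots of
`a₁` are stable, and the state response may keep them, so its new denominator is `a₁ d'`. The input
numerator is corrected by `E` with `a₂ ∣ d E - (d' - d) N`; this makes
`adj (zI - A) (d' I + B (N + E))` divisible by `a₂`, and the quotient is the new state numerator.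
The correction is linear in the coefficients of `d' - d`, and all denominators are bounded away
from zero on `1 < |z|`, uniformly in the perturbed roots. So the responses move by `O(1 / √n)`, and
the cost is Lipschitz in them. The new `Φu` has simple poles on the spiral, and comparing principal
parts in the constraint gives the coefficient equations of the simple pole approximation.
-/

/-- The Archimedes spiral at scale `s`; the points of `spiralPoles n` lie on it at scale `√n`,
at the parameters `x = √k`. -/
noncomputable def spiral (s x : ℝ) : ℂ :=
  ((x / s : ℝ) : ℂ) * Complex.exp (((2 * √Real.pi * x : ℝ) : ℂ) * Complex.I)

section Spiral

open Filter Finset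

theorem spiralPole_eq_spiral (n k : ℕ) : spiralPole n k = spiral √n √k := by
  rw [spiralPole, spiral, Real.sqrt_div k.cast_nonneg, Real.sqrt_mul Real.pi_pos.le, mul_assoc]

theorem norm_spiralPole (n k : ℕ) : ‖spiralPole n k‖ = √((k : ℝ) / n) := by
  rw [spiralPole, norm_mul, Complex.norm_exp_ofReal_mul_I, mul_one, Complex.norm_real,
    Real.norm_of_nonneg (Real.sqrt_nonneg _)]

theorem norm_spiralPole_lt_one {n k : ℕ} (hk : k < n) : ‖spiralPole n k‖ < 1 := by
  have hn : (0 : ℝ) < n := by exact_mod_cast k.zero_le.trans_lt hk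
  rw [norm_spiralPole, Real.sqrt_lt' one_pos, one_pow, div_lt_one hn]
  exact_mod_cast hk

theorem eq_of_norm_spiralPole_eq {n k l : ℕ} (hn : 0 < n)
    (h : ‖spiralPole n k‖ = ‖spiralPole n l‖) : k = l := by
  have hn' : (0 : ℝ) < n := by exact_mod_cast hn
  rw [norm_spiralPole, norm_spiralPole, Real.sqrt_inj (by positivity) (by positivity),
    div_left_inj' hn'.ne'] at h
  exact_mod_cast h

theorem im_spiralPole_ne_zero {n k : ℕ} (hn : 0 < n) (hk : 0 < k) : (spiralPole n k).im ≠ 0 := by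
  have hk' : (0 : ℝ) < k := by exact_mod_cast hk
  rw [spiralPole, Complex.im_ofReal_mul, Complex.exp_ofReal_mul_I_im]
  refine mul_ne_zero (Real.sqrt_pos.2 (by positivity)).ne' fun h => ?_
  obtain ⟨j, hj⟩ := Real.sin_eq_zero_iff.1 h
  have hsq : (j * Real.pi) ^ 2 = 4 * (Real.pi * k) := by
    rw [hj, mul_pow, Real.sq_sqrt (by positivity)]; norm_num
  have hjpi : (j : ℝ) ^ 2 * Real.pi = 4 * k :=
    mul_left_cancel₀ Real.pi_ne_zero (by linarith)
  have hj0 : (j : ℝ) ^ 2 ≠ 0 := by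
    intro h0
    rw [h0] at hjpi
    linarith
  refine irrational_pi ⟨4 * k / (j : ℚ) ^ 2, ?_⟩
  push_cast
  rw [div_eq_iff hj0]
  linarith

@[to_additive]
theorem prod_spiralPoles {M : Type*} [CommMonoid M] {n : ℕ} (hn : 0 < n) (f : ℂ → M) :
    ∏ s ∈ spiralPoles n, f s =
      ∏ k ∈ Ico 1 n, f (spiralPole n k) * f (starRingEnd ℂ (spiralPole n k)) := by
  rw [spiralPoles, prod_union, prod_image, prod_image, prod_mul_distrib]
  · exact fun k _ l _ h =>
      eq_of_norm_spiralPole_eq hn (congrArg norm ((starRingEnd ℂ).injective h))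
  · exact fun k _ l _ h => eq_of_norm_spiralPole_eq hn (congrArg norm h)
  · rw [disjoint_left]
    intro z hz hz'
    obtain ⟨k, hk, rfl⟩ := mem_image.1 hz
    obtain ⟨l, -, hl⟩ := mem_image.1 hz'
    obtain rfl : l = k := eq_of_norm_spiralPole_eq hn (by rw [← hl, RCLike.norm_conj])
    exact im_spiralPole_ne_zero hn (mem_Ico.1 hk).1 (Complex.conj_eq_iff_im.1 hl)

theorem card_spiralPoles_add_two {n : ℕ} (hn : 0 < n) : #(spiralPoles n) + 2 = 2 * n := by
  rw [card_eq_sum_ones, sum_spiralPoles hn, sum_const, Nat.card_Ico, smul_eq_mul]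
  omega

theorem norm_lt_one_of_mem_spiralPoles {n : ℕ} {z : ℂ} (hz : z ∈ spiralPoles n) : ‖z‖ < 1 := by
  simp only [spiralPoles, mem_union, mem_image, mem_Ico] at hz
  obtain ⟨k, ⟨-, hk⟩, rfl⟩ | ⟨k, ⟨-, hk⟩, rfl⟩ := hz
  · exact norm_spiralPole_lt_one hk
  · rw [RCLike.norm_conj]
    exact norm_spiralPole_lt_one hk

theorem norm_ofReal_mul_exp_sub_le (a b α β : ℝ) :
    ‖(a : ℂ) * Complex.exp (α * Complex.I) - b * Complex.exp (β * Complex.I)‖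
      ≤ |a - b| + |a| * |α - β| := by
  have hα : Complex.exp (α * Complex.I) = Complex.exp (β * Complex.I) *
      Complex.exp (Complex.I * ((α - β : ℝ) : ℂ)) := by
    rw [← Complex.exp_add]; congr 1; push_cast; ring
  calc _ = ‖((a - b : ℝ) : ℂ) * Complex.exp (β * Complex.I) + a * (Complex.exp (β * Complex.I) *
          (Complex.exp (Complex.I * ((α - β : ℝ) : ℂ)) - 1))‖ := by
        rw [hα]; push_cast; ring_nf
    _ ≤ |a - b| + |a| * ‖Complex.exp (Complex.I * ((α - β : ℝ) : ℂ)) - 1‖ := by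
        refine (norm_add_le _ _).trans_eq ?_
        simp only [norm_mul, Complex.norm_exp_ofReal_mul_I, Complex.norm_real, Real.norm_eq_abs,
          mul_one, one_mul]
    _ ≤ |a - b| + |a| * |α - β| := by
        gcongr
        exact Real.norm_exp_I_mul_ofReal_sub_one_le

theorem norm_spiral_sub_spiral_le {s x y : ℝ} (hs : 0 ≤ s) (hxy : x ≤ y) (hy : 0 ≤ y) :
    ‖spiral s y - spiral s x‖ ≤ ((y - x) + 2 * √Real.pi * (y * (y - x))) / s := by
  refine (norm_ofReal_mul_exp_sub_le _ _ _ _).trans_eq ?_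
  rw [← sub_div, ← mul_sub, abs_mul, abs_div, abs_div, abs_of_nonneg (sub_nonneg.2 hxy),
    abs_of_nonneg hy, abs_of_nonneg hs, abs_of_nonneg (by positivity : 0 ≤ 2 * √Real.pi)]
  ring

theorem exists_mem_Ico_eq_norm_mul_exp (r : ℂ) (t : ℝ) :
    ∃ θ ∈ Set.Ico t (t + 2 * Real.pi), r = ‖r‖ * Complex.exp (θ * Complex.I) := by
  obtain ⟨j, hj, -⟩ := existsUnique_add_zsmul_mem_Ico Real.two_pi_pos r.arg t
  refine ⟨_, hj, ?_⟩
  have hangle : ((r.arg + j • (2 * Real.pi) : ℝ) : ℂ) * Complex.I =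
      r.arg * Complex.I + j * (2 * Real.pi * Complex.I) := by
    push_cast [zsmul_eq_mul]; ring
  rw [hangle, Complex.exp_add, Complex.exp_int_mul_two_pi_mul_I, mul_one,
    Complex.norm_mul_exp_arg_mul_I]

-- Consecutive turns of the spiral are `√π / s` apart; `x` is taken on the turn just outside `r`.
theorem exists_norm_spiral_sub_le {s : ℝ} (hs : 0 < s) (r : ℂ) :
    ∃ x, s * ‖r‖ ≤ x ∧ x ≤ s * ‖r‖ + √Real.pi ∧ ‖spiral s x - r‖ ≤ √Real.pi / s := by
  have hww : √Real.pi * √Real.pi = Real.pi := Real.mul_self_sqrt Real.pi_pos.le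
  obtain ⟨θ, ⟨hθ₁, hθ₂⟩, hr⟩ := exists_mem_Ico_eq_norm_mul_exp r (2 * √Real.pi * (s * ‖r‖))
  obtain ⟨x, rfl⟩ : ∃ x, θ = 2 * √Real.pi * x := ⟨θ / (2 * √Real.pi), by field_simp⟩
  have hx₁ : s * ‖r‖ ≤ x := le_of_mul_le_mul_left hθ₁ (by positivity)
  have hx₂ : x < s * ‖r‖ + √Real.pi := by
    refine lt_of_mul_lt_mul_left (hθ₂.trans_eq ?_) (by positivity : 0 ≤ 2 * √Real.pi)
    rw [mul_add, mul_assoc 2 _ √Real.pi, hww]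
  refine ⟨x, hx₁, hx₂.le, ?_⟩
  have hradial : |x / s - ‖r‖| ≤ √Real.pi / s := by
    rw [abs_of_nonneg (sub_nonneg.2 ((le_div_iff₀' hs).2 hx₁)), sub_le_iff_le_add,
      ← sub_le_iff_le_add', div_sub_div_same, div_le_iff₀' hs]
    linarith
  calc ‖spiral s x - r‖ ≤ |x / s - ‖r‖| + |x / s| * |2 * √Real.pi * x - 2 * √Real.pi * x| := by
        conv_lhs => rw [hr]
        exact norm_ofReal_mul_exp_sub_le _ _ _ _
    _ ≤ √Real.pi / s := by simpa using hradial

theorem sqrt_sub_le_of_mem_Ico_floor_sq {x : ℝ} (hx : 0 ≤ x) {k M : ℕ}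
    (hk : k ∈ Ico (⌊x ^ 2⌋₊ + 1) (⌊x ^ 2⌋₊ + 1 + M)) :
    x ≤ √k ∧ √k - x ≤ M ∧ √k * (√k - x) ≤ M := by
  obtain ⟨hk₁, hk₂⟩ := mem_Ico.1 hk
  have hxk : x ^ 2 ≤ k := (Nat.lt_floor_add_one _).le.trans (by exact_mod_cast hk₁)
  have hkx : (k : ℝ) ≤ x ^ 2 + M := by
    have hk₃ : (k : ℝ) ≤ ⌊x ^ 2⌋₊ + M := by exact_mod_cast (by omega : k ≤ ⌊x ^ 2⌋₊ + M)
    linarith [Nat.floor_le (sq_nonneg x)]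
  have hle : x ≤ √k := Real.le_sqrt_of_sq_le hxk
  have hone : 1 ≤ √(k : ℝ) := Real.one_le_sqrt.2 (by exact_mod_cast (by omega : 1 ≤ k))
  have hsq : √(k : ℝ) * √k = k := Real.mul_self_sqrt k.cast_nonneg
  have hmul : √k * (√k - x) ≤ M := by nlinarith
  exact ⟨hle, by nlinarith, hmul⟩

theorem exists_spiralPole_near (M : ℕ) : ∃ K : ℝ, 0 ≤ K ∧ ∀ r : ℂ, ‖r‖ < 1 → ∀ᶠ n : ℕ in atTop,
    ∃ T ⊆ Ico 1 n, #T = M ∧ ∀ k ∈ T, ‖spiralPole n k - r‖ ≤ K / √n := by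
  refine ⟨M + 2 * √Real.pi * M + √Real.pi, by positivity, fun r hr => ?_⟩
  have hlarge : ∀ᶠ n : ℕ in atTop, (√Real.pi + M) / (1 - ‖r‖) < √n :=
    (Real.tendsto_sqrt_atTop.comp tendsto_natCast_atTop_atTop).eventually_gt_atTop _
  filter_upwards [hlarge, eventually_gt_atTop 0] with n hn hn0
  have hs : 0 < √(n : ℝ) := Real.sqrt_pos.2 (by exact_mod_cast hn0)
  rw [div_lt_iff₀ (sub_pos.2 hr)] at hn
  obtain ⟨x, hx₁, hx₂, hxr⟩ := exists_norm_spiral_sub_le hs r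
  have hx : 0 ≤ x := le_trans (by positivity) hx₁
  refine ⟨Ico (⌊x ^ 2⌋₊ + 1) (⌊x ^ 2⌋₊ + 1 + M), fun k hk => ?_, by simp, fun k hk => ?_⟩
  · have hkn : √(k : ℝ) < √n := by linarith [(sqrt_sub_le_of_mem_Ico_floor_sq hx hk).2.1]
    have hkn' : k < n := by exact_mod_cast (Real.sqrt_lt_sqrt_iff k.cast_nonneg).1 hkn
    exact mem_Ico.2 ⟨by have := (mem_Ico.1 hk).1; omega, hkn'⟩
  · obtain ⟨hle, hsub, hmul⟩ := sqrt_sub_le_of_mem_Ico_floor_sq hx hk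
    calc ‖spiralPole n k - r‖ ≤ ‖spiral √n √k - spiral √n x‖ + ‖spiral √n x - r‖ := by
          rw [spiralPole_eq_spiral]
          exact norm_sub_le_norm_sub_add_norm_sub _ _ _
      _ ≤ (M + 2 * √Real.pi * M) / √n + √Real.pi / √n := by
          refine add_le_add ((norm_spiral_sub_spiral_le hs.le hle (by positivity)).trans ?_) hxr
          gcongr
      _ = (M + 2 * √Real.pi * M + √Real.pi) / √n := (add_div _ _ _).symm

theorem exists_injective_spiralPole_near (ι : Type*) [Fintype ι] :
    ∃ K : ℝ, ∀ r : ι → ℂ, ‖r‖ < 1 → ∀ᶠ n : ℕ in atTop,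
      ∃ κ : ι → ℕ, Function.Injective κ ∧ (∀ i, κ i ∈ Ico 1 n) ∧
        ‖(fun i => spiralPole n (κ i)) - r‖ ≤ K / √n := by
  obtain ⟨K, hK0, hK⟩ := exists_spiralPole_near (Fintype.card ι)
  refine ⟨K, fun r hr => ?_⟩
  filter_upwards [eventually_all.2 fun i => hK (r i) ((norm_le_pi_norm r i).trans_lt hr)] with n hn
  choose T hTn hTcard hT using hn
  have hall : ∀ s : Finset ι, #s ≤ #(s.biUnion T) := by
    intro s
    obtain rfl | ⟨i, hi⟩ := s.eq_empty_or_nonempty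
    · simp
    · calc #s ≤ #(T i) := (hTcard i).symm ▸ s.card_le_univ
        _ ≤ #(s.biUnion T) := card_le_card (subset_biUnion_of_mem T hi)
  obtain ⟨κ, hκ, hκT⟩ := (all_card_le_biUnion_card_iff_exists_injective T).1 hall
  exact ⟨κ, hκ, fun i => hTn i (hκT i),
    (pi_norm_le_iff_of_nonneg (by positivity)).2 fun i => hT i _ (hκT i)⟩

end Spiral

section ConjProd

open Polynomial

/-- The real quadratic polynomial with roots `z` and its complex conjugate. -/
noncomputable def conjQuad (z : ℂ) : ℝ[X] := X ^ 2 - C (2 * z.re) * X + C (Complex.normSq z)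

theorem map_conjQuad (z : ℂ) : (conjQuad z).map (algebraMap ℝ ℂ) =
    (X - C z) * (X - C (starRingEnd ℂ z)) := by
  have hsum : ((2 * z.re : ℝ) : ℂ) = z + starRingEnd ℂ z := (Complex.add_conj z).symm
  have hprod : ((Complex.normSq z : ℝ) : ℂ) = z * starRingEnd ℂ z := (Complex.mul_conj z).symm
  rw [conjQuad, Polynomial.map_add, Polynomial.map_sub, Polynomial.map_pow, Polynomial.map_mul,
    map_X, map_C, map_C, Complex.coe_algebraMap, hsum, hprod, C_add, C_mul]
  ring

theorem monic_conjQuad (z : ℂ) : (conjQuad z).Monic := by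
  refine monic_of_injective (algebraMap ℝ ℂ).injective ?_
  rw [map_conjQuad]
  exact (monic_X_sub_C _).mul (monic_X_sub_C _)

theorem natDegree_conjQuad (z : ℂ) : (conjQuad z).natDegree = 2 := by
  rw [← natDegree_map (algebraMap ℝ ℂ), map_conjQuad,
    (monic_X_sub_C _).natDegree_mul (monic_X_sub_C _), natDegree_X_sub_C, natDegree_X_sub_C]

theorem contDiff_coeff_conjQuad (j : ℕ) : ContDiff ℝ 1 fun z => (conjQuad z).coeff j := by
  have hre : ContDiff ℝ 1 Complex.re := Complex.reCLM.contDiff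
  have him : ContDiff ℝ 1 Complex.im := Complex.imCLM.contDiff
  simp only [conjQuad, coeff_add, coeff_sub, coeff_C_mul, coeff_C, Complex.normSq_apply]
  split_ifs <;> fun_prop

variable {ι : Type*} [Fintype ι]

/-- The real polynomial whose roots are the `w i` and their complex conjugates: the denominator of
a transfer function with poles `w i`. -/
noncomputable def conjProd (w : ι → ℂ) : ℝ[X] := ∏ i, conjQuad (w i)

theorem map_conjProd (w : ι → ℂ) : (conjProd w).map (algebraMap ℝ ℂ) =
    ∏ i, ((X - C (w i)) * (X - C (starRingEnd ℂ (w i)))) := by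
  simp only [conjProd, Polynomial.map_prod, map_conjQuad]

theorem monic_conjProd (w : ι → ℂ) : (conjProd w).Monic :=
  monic_prod_of_monic _ _ fun i _ => monic_conjQuad (w i)

theorem natDegree_conjProd (w : ι → ℂ) : (conjProd w).natDegree = 2 * Fintype.card ι := by
  rw [conjProd, natDegree_prod_of_monic _ _ fun i _ => monic_conjQuad (w i)]
  simp [natDegree_conjQuad, mul_comm]

theorem degree_conjProd_sub_lt (w r : ι → ℂ) :
    (conjProd w - conjProd r).degree < (conjProd r).degree := by
  have hdeg : (conjProd r).degree = (conjProd w).degree := by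
    rw [degree_eq_natDegree (monic_conjProd r).ne_zero, natDegree_conjProd,
      degree_eq_natDegree (monic_conjProd w).ne_zero, natDegree_conjProd]
  rw [hdeg]
  exact degree_sub_lt_left hdeg.symm (monic_conjProd w).ne_zero
    ((monic_conjProd w).leadingCoeff.trans (monic_conjProd r).leadingCoeff.symm)

theorem norm_le_of_aeval_conjProd_eq_zero {w : ι → ℂ} {s : ℂ} (hs : aeval s (conjProd w) = 0) :
    ‖s‖ ≤ ‖w‖ := by
  rw [← eval_map_algebraMap, map_conjProd, eval_prod, Finset.prod_eq_zero_iff] at hs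
  obtain ⟨i, -, hi⟩ := hs
  rw [eval_mul, eval_sub, eval_sub, eval_X, eval_C, eval_C, mul_eq_zero, sub_eq_zero,
    sub_eq_zero] at hi
  obtain rfl | rfl := hi
  · exact norm_le_pi_norm w i
  · rw [RCLike.norm_conj]
    exact norm_le_pi_norm w i

theorem contDiff_coeff_prod_conjQuad (s : Finset ι) (j : ℕ) :
    ContDiff ℝ 1 fun w : ι → ℂ => (∏ i ∈ s, conjQuad (w i)).coeff j := by
  induction s using Finset.cons_induction generalizing j with
  | empty => simp only [Finset.prod_empty]; exact contDiff_const
  | cons a s ha ih =>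
    simp only [Finset.prod_cons, coeff_mul]
    exact ContDiff.sum fun x _ =>
      ((contDiff_coeff_conjQuad x.1).comp (contDiff_apply ℝ ℂ a)).mul (ih x.2)

theorem exists_lipschitzOnWith_coeff_conjProd (ι : Type*) [Fintype ι] (ρ : ℝ) (l : ℕ) :
    ∃ L, LipschitzOnWith L (fun (w : ι → ℂ) (j : Fin l) => (conjProd w).coeff j)
      (Metric.closedBall 0 ρ) :=
  have hcontDiff : ContDiff ℝ 1 fun (w : ι → ℂ) (j : Fin l) => (conjProd w).coeff j :=
    contDiff_pi.2 fun _ => contDiff_coeff_prod_conjQuad Finset.univ _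
  hcontDiff.contDiffOn.exists_lipschitzOnWith one_ne_zero (convex_closedBall 0 ρ)
    (isCompact_closedBall 0 ρ)

theorem exists_conjProd_eq_mul_self {f : ℝ[X]} (hf : f.Monic) :
    ∃ w : (f.map (algebraMap ℝ ℂ)).roots → ℂ, (∀ i, aeval (w i) f = 0) ∧ conjProd w = f * f := by
  set g := f.map (algebraMap ℝ ℂ)
  refine ⟨fun i => i, fun i => ?_, map_injective _ (algebraMap ℝ ℂ).injective ?_⟩
  · rw [← eval_map_algebraMap]
    exact (mem_roots'.1 (Multiset.coe_mem (x := i))).2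
  have hroots : ∏ i : g.roots, (X - C (i : ℂ)) = g := by
    rw [Finset.prod_eq_multiset_prod, Multiset.map_univ g.roots fun a => X - C a]
    exact ((IsAlgClosed.splits g).eq_prod_roots_of_monic (hf.map _)).symm
  have hconj : ∏ i : g.roots, (X - C (starRingEnd ℂ (i : ℂ))) = g := by
    have hg : g.map (starRingEnd ℂ) = g := by
      rw [Polynomial.map_map]; congr 1; ext x; simp
    conv_rhs => rw [← hg, ← hroots]
    simp only [Polynomial.map_prod, Polynomial.map_sub, map_X, map_C]
  rw [map_conjProd, Finset.prod_mul_distrib, hroots, hconj, Polynomial.map_mul]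

theorem map_conjProd_spiralPole_dvd {n : ℕ} (hn : 0 < n) {κ : ι → ℕ} (hκ : Function.Injective κ)
    (hκn : ∀ i, κ i ∈ Finset.Ico 1 n) :
    (conjProd fun i => spiralPole n (κ i)).map (algebraMap ℝ ℂ) ∣
      ∏ s ∈ spiralPoles n, (X - C s) := by
  classical
  rw [map_conjProd, prod_spiralPoles hn, ← Finset.prod_image (g := κ) (s := Finset.univ)
    (f := fun k => (X - C (spiralPole n k)) * (X - C (starRingEnd ℂ (spiralPole n k))))
    fun i _ j _ h => hκ h]
  exact Finset.prod_dvd_prod_of_subset _ _ _ (Finset.image_subset_iff.2 fun i _ => hκn i)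

end ConjProd

section PrincipalPart

open Polynomial Finset

variable {K E : Type*} [Field K] [AddCommGroup E] [Module K E]

/-- The sum of the principal parts at the poles `s ∈ U`, of order at most `L s`, with coefficient
`G s i` of `(z - s)⁻ⁱ`. Values of `G s` outside `1, …, L s` play no role. -/
def principalPart (U : Finset K) (L : K → ℕ) (G : K → ℕ → E) (z : K) : E :=
  ∑ s ∈ U, ∑ i ∈ Icc 1 (L s), ((z - s) ^ i)⁻¹ • G s i

theorem principalPart_zero (U : Finset K) (L : K → ℕ) (z : K) :
    principalPart U L (0 : K → ℕ → E) z = 0 := by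
  simp [principalPart]

theorem principalPart_add (U : Finset K) (L : K → ℕ) (G H : K → ℕ → E) (z : K) :
    principalPart U L (G + H) z = principalPart U L G z + principalPart U L H z := by
  simp only [principalPart, Pi.add_apply, smul_add, sum_add_distrib]

theorem principalPart_single [DecidableEq K] {U : Finset K} {L : K → ℕ} {s : K} {k : ℕ}
    (hs : s ∈ U) (hk : k ∈ Icc 1 (L s)) (e : E) (z : K) :
    principalPart U L (Pi.single s (Pi.single k e)) z = ((z - s) ^ k)⁻¹ • e := by
  rw [principalPart, sum_eq_single_of_mem s hs, sum_eq_single_of_mem k hk, Pi.single_eq_same,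
    Pi.single_eq_same]
  · intro i _ hi
    rw [Pi.single_eq_same, Pi.single_eq_of_ne hi, smul_zero]
  · intro t _ ht
    simp only [Pi.single_eq_of_ne ht, Pi.zero_apply, smul_zero, sum_const_zero]

theorem principalPart_apply {a b : Type*} (U : Finset K) (L : K → ℕ) (G : K → ℕ → Matrix a b K)
    (z : K) (i : a) (j : b) :
    principalPart U L G z i j = principalPart U L (fun s k => G s k i j) z := by
  simp only [principalPart, Matrix.sum_apply, Matrix.smul_apply]

theorem mul_principalPart {a b c : Type*} [Fintype b] (B : Matrix a b K) (U : Finset K) (L : K → ℕ)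
    (G : K → ℕ → Matrix b c K) (z : K) :
    B * principalPart U L G z = principalPart U L (fun s i => B * G s i) z := by
  simp only [principalPart, Matrix.mul_sum, Matrix.mul_smul]

theorem eval_prod_X_sub_C (m : Multiset K) (z : K) :
    (m.map fun s => X - C s).prod.eval z = (m.map fun s => z - s).prod := by
  simp [eval_multiset_prod]

-- Subtracting `γ / (z - a) ^ k`, with `γ` the leading coefficient at a pole `a` of order `k`,
-- lowers the order of that pole.
theorem exists_eval_div_eq_add_eval_div [DecidableEq K] (a : K) (m : Multiset K) {g : K[X]}
    (hg : g.degree < (a ::ₘ m).card) : ∃ (γ : K) (g' : K[X]), g'.degree < m.card ∧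
      ∀ z ∉ a ::ₘ m, g.eval z / ((a ::ₘ m).map fun s => z - s).prod =
        g'.eval z / (m.map fun s => z - s).prod + ((z - a) ^ (m.count a + 1))⁻¹ * γ := by
  set m' := m.filter fun s => ¬ a = s
  set h : K[X] := (m'.map fun s => X - C s).prod with hh
  have hha : h.eval a ≠ 0 := by
    rw [hh, eval_prod_X_sub_C, Ne, Multiset.prod_eq_zero_iff]
    simp only [Multiset.mem_map, not_exists, not_and, sub_eq_zero]
    exact fun s hs has => Multiset.of_mem_filter hs has
  have hprod (z : K) : (m.map fun s => z - s).prod = (z - a) ^ m.count a * h.eval z := by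
    conv_lhs => rw [← Multiset.filter_add_not (a = ·) m]
    rw [Multiset.map_add, Multiset.prod_add, Multiset.filter_eq, Multiset.map_replicate,
      Multiset.prod_replicate, hh, eval_prod_X_sub_C]
  obtain ⟨g', hg'⟩ : X - C a ∣ g - C (g.eval a / h.eval a) * h := by
    rw [dvd_iff_isRoot, IsRoot.def, eval_sub, eval_mul, eval_C, div_mul_cancel₀ _ hha, sub_self]
  refine ⟨g.eval a / h.eval a, g', ?_, fun z hz => ?_⟩
  · have hhm : (C (g.eval a / h.eval a) * h).degree < ((a ::ₘ m).card : WithBot ℕ) := by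
      have hle : h.natDegree ≤ m.card :=
        (natDegree_multiset_prod_X_sub_C_eq_card m').trans_le
          (Multiset.card_le_card (Multiset.filter_le _ m))
      rw [Multiset.card_cons]
      refine (degree_mul_le _ _).trans_lt
        ((add_le_add degree_C_le (natDegree_le_iff_degree_le.1 hle)).trans_lt ?_)
      rw [zero_add]
      exact_mod_cast m.card.lt_succ_self
    have hlt := (degree_sub_le g (C (g.eval a / h.eval a) * h)).trans_lt (max_lt hg hhm)
    rw [hg', degree_mul, degree_X_sub_C, Multiset.card_cons, Nat.cast_add_one, add_comm] at hlt
    exact lt_of_add_lt_add_right hlt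
  · have hza : z - a ≠ 0 := sub_ne_zero.2 fun hza => hz (hza ▸ Multiset.mem_cons_self a m)
    have hzm : (m.map fun s => z - s).prod ≠ 0 := by
      rw [Ne, Multiset.prod_eq_zero_iff]
      simp only [Multiset.mem_map, not_exists, not_and, sub_eq_zero]
      exact fun s hs hzs => hz (hzs ▸ Multiset.mem_cons_of_mem hs)
    have hzh : h.eval z ≠ 0 := right_ne_zero_of_mul (hprod z ▸ hzm)
    have hgz : g.eval z = (z - a) * g'.eval z + g.eval a / h.eval a * h.eval z := by
      have := congrArg (eval z) hg'
      simp only [eval_sub, eval_mul, eval_C, eval_X] at this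
      linear_combination this
    rw [Multiset.map_cons, Multiset.prod_cons, hprod, hgz]
    field_simp
    ring

theorem exists_eval_div_eq_principalPart_of_multiset [DecidableEq K] (m : Multiset K) (g : K[X])
    (hg : g.degree < m.card) : ∃ c : K → ℕ → K, (∀ s i, m.count s < i → c s i = 0) ∧
      ∀ (U : Finset K) (L : K → ℕ), (∀ s ∈ m, s ∈ U) → (∀ s ∈ U, m.count s ≤ L s) →
        ∀ z ∉ m, g.eval z / (m.map fun s => z - s).prod = principalPart U L c z := by
  induction m using Multiset.induction_on generalizing g with
  | empty =>
    have hg0 : g = 0 := by simpa [Nat.WithBot.lt_zero_iff] using hg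
    exact ⟨0, fun _ _ _ => rfl, fun U L _ _ z _ => by rw [hg0, principalPart_zero]; simp⟩
  | cons a m ih =>
    obtain ⟨γ, g', hg', hdiv⟩ := exists_eval_div_eq_add_eval_div a m hg
    obtain ⟨c, hc, hcz⟩ := ih g' hg'
    have hcount (s : K) : m.count s ≤ (a ::ₘ m).count s := Multiset.count_le_count_cons s a m
    refine ⟨c + Pi.single a (Pi.single (m.count a + 1) γ), fun s i hi => ?_,
      fun U L hU hL z hz => ?_⟩
    · rw [Pi.add_apply, Pi.add_apply, hc s i ((hcount s).trans_lt hi), zero_add]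
      obtain rfl | hs := eq_or_ne s a
      · rw [Multiset.count_cons_self] at hi
        rw [Pi.single_eq_same, Pi.single_eq_of_ne hi.ne']
      · rw [Pi.single_eq_of_ne hs, Pi.zero_apply]
    · have haU := hU a (Multiset.mem_cons_self a m)
      have haL := hL a haU
      rw [Multiset.count_cons_self] at haL
      rw [hdiv z hz, principalPart_add,
        principalPart_single haU (Finset.mem_Icc.2 ⟨Nat.le_add_left 1 _, haL⟩), smul_eq_mul,
        hcz U L (fun s hs => hU s (Multiset.mem_cons_of_mem hs))
          (fun s hs => (hcount s).trans (hL s hs)) z fun h => hz (Multiset.mem_cons_of_mem h)]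

theorem exists_eval_div_eval_eq_principalPart {f : K[X]} (hf : f.Monic) (hsplit : f.Splits)
    {g : K[X]} (hg : g.degree < f.degree) :
    ∃ c : K → ℕ → K, (∀ s i, f.rootMultiplicity s < i → c s i = 0) ∧
      ∀ (U : Finset K) (L : K → ℕ), (∀ s, f.eval s = 0 → s ∈ U) →
        (∀ s ∈ U, f.rootMultiplicity s ≤ L s) →
          ∀ z, f.eval z ≠ 0 → g.eval z / f.eval z = principalPart U L c z := by
  classical
  rw [degree_eq_natDegree hf.ne_zero, hsplit.natDegree_eq_card_roots] at hg
  obtain ⟨c, hc, hcz⟩ := exists_eval_div_eq_principalPart_of_multiset f.roots g hg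
  simp only [count_roots] at hc hcz
  refine ⟨c, hc, fun U L hU hL z hz => ?_⟩
  rw [hsplit.eval_eq_prod_roots_of_monic hf]
  exact hcz U L (fun s hs => hU s (isRoot_of_mem_roots hs)) hL z fun h => hz (isRoot_of_mem_roots h)

theorem sum_Icc_one_eq_sum_range {M : Type*} [AddCommMonoid M] (f : ℕ → M) (L : ℕ) :
    ∑ i ∈ Icc 1 L, f i = ∑ i ∈ range L, f (i + 1) := by
  rw [range_eq_Ico, sum_Ico_add' f 0 L 1]
  rfl

theorem eq_zero_of_add_principalPart_eq_zero {Z : Set K} (hZ : Z.Infinite) {U : Finset K}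
    (hU : ∀ s ∈ U, s ∉ Z) {L : K → ℕ} {c₀ : K} {c : K → ℕ → K}
    (h : ∀ z ∈ Z, c₀ + principalPart U L c z = 0) :
    c₀ = 0 ∧ ∀ s ∈ U, ∀ i ∈ Icc 1 (L s), c s i = 0 := by
  let evalZ : K[X] →+* (Z → K) := RingHom.pi fun z => evalRingHom (z : K)
  let _ : Algebra K[X] (Z → K) := evalZ.toAlgebra
  have hmap (f : K[X]) (z : Z) : algebraMap K[X] (Z → K) f z = f.eval (z : K) := rfl
  have _ : FaithfulSMul K[X] (Z → K) := (faithfulSMul_iff_algebraMap_injective _ _).2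
    fun f g hfg => eq_of_infinite_eval_eq f g (hZ.mono fun z hz => congrFun hfg ⟨z, hz⟩)
  obtain ⟨h₀, hc⟩ := quo_add_sum_rem_mul_pow_inverse_unique (s := U) (K := Z → K)
    (g := fun s => X - C s) (fun s _ => monic_X_sub_C s)
    (fun s _ t _ hst => isCoprime_X_sub_C_of_isUnit_sub (sub_ne_zero.2 hst).isUnit)
    (n := L) (gi := fun s z => ((z : K) - s)⁻¹)
    (fun s hs => funext fun z => by
      simp only [Pi.mul_apply, Pi.one_apply, hmap, eval_sub, eval_X, eval_C]
      exact inv_mul_cancel₀ (sub_ne_zero.2 fun hzs => hU s hs (hzs ▸ z.2)))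
    (q₁ := C c₀) (q₂ := 0) (r₁ := fun s j => C (c s (j + 1))) (r₂ := fun _ _ => 0)
    (fun s _ _ => by rw [degree_X_sub_C]; exact degree_C_le.trans_lt zero_lt_one)
    (fun s _ _ => by rw [degree_X_sub_C, degree_zero]; exact WithBot.bot_lt_coe 1)
    (by
      funext z
      simp only [hmap, zero_mul, sum_const_zero, map_zero, add_zero, Pi.add_apply, Finset.sum_apply,
        Pi.mul_apply, Pi.pow_apply, eval_C, Pi.zero_apply]
      simpa only [principalPart, sum_Icc_one_eq_sum_range, sum_range, smul_eq_mul, inv_pow,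
        mul_comm] using h z z.2)
  refine ⟨C_eq_zero.1 h₀, fun s hs i hi => ?_⟩
  obtain ⟨hi, hiL⟩ := mem_Icc.1 hi
  have hci := C_eq_zero.1 (congrFun (hc s hs) ⟨i - 1, by lia⟩)
  rwa [Nat.sub_add_cancel hi] at hci

variable {a b k : Type*} [Fintype a] [DecidableEq a]

theorem scalar_sub_mul_principalPart (A : Matrix a a K) {U : Finset K} {L : K → ℕ}
    {G : K → ℕ → Matrix a k K} (hG : ∀ s ∈ U, G s (L s + 1) = 0) {z : K} (hz : z ∉ U) :
    (Matrix.scalar a z - A) * principalPart U L G z = ∑ s ∈ U, G s 1 +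
      principalPart U L (fun s i => G s (i + 1) + (Matrix.scalar a s - A) * G s i) z := by
  have hterm (s : K) (hs : s ∈ U) (i : ℕ) :
      (Matrix.scalar a z - A) * (((z - s) ^ (i + 1))⁻¹ • G s (i + 1)) =
        (((z - s) ^ i)⁻¹ • G s (i + 1) - ((z - s) ^ (i + 1))⁻¹ • G s (i + 2)) +
          ((z - s) ^ (i + 1))⁻¹ • (G s (i + 2) + (Matrix.scalar a s - A) * G s (i + 1)) := by
    have hzs : z - s ≠ 0 := sub_ne_zero.2 fun hzs => hz (hzs ▸ hs)
    have hA : Matrix.scalar a z - A = (z - s) • 1 + (Matrix.scalar a s - A) := by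
      simp only [Matrix.scalar_apply, ← Matrix.smul_one_eq_diagonal]
      module
    have hpow : ((z - s) ^ (i + 1))⁻¹ * (z - s) = ((z - s) ^ i)⁻¹ := by
      rw [pow_succ, mul_inv, inv_mul_cancel_right₀ hzs]
    rw [hA, Matrix.mul_smul, Matrix.add_mul, Matrix.smul_mul, Matrix.one_mul, smul_add,
      smul_smul, hpow, smul_add]
    abel
  simp only [principalPart, sum_Icc_one_eq_sum_range]
  rw [Matrix.mul_sum, ← sum_add_distrib]
  refine sum_congr rfl fun s hs => ?_
  rw [Matrix.mul_sum, sum_congr rfl fun i _ => hterm s hs i, sum_add_distrib,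
    sum_range_sub' fun i => ((z - s) ^ i)⁻¹ • G s (i + 1), hG s hs, smul_zero, sub_zero, pow_zero,
    inv_one, one_smul]

theorem coeff_eq_of_scalar_sub_mul_principalPart_sub_eq [Fintype b] {A : Matrix a a K}
    {B : Matrix a b K} {Z : Set K} (hZ : Z.Infinite) {U : Finset K} (hU : ∀ s ∈ U, s ∉ Z)
    {L : K → ℕ} {G : K → ℕ → Matrix a k K} (hG : ∀ s ∈ U, G s (L s + 1) = 0)
    {F : K → ℕ → Matrix b k K} {E₀ : Matrix a k K}
    (h : ∀ z ∈ Z, (Matrix.scalar a z - A) * principalPart U L G z - B * principalPart U L F z =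
      E₀) :
    ∑ s ∈ U, G s 1 = E₀ ∧ ∀ s ∈ U, ∀ i ∈ Icc 1 (L s),
      G s (i + 1) + (Matrix.scalar a s - A) * G s i = B * F s i := by
  have hentry (x : a) (y : k) := eq_zero_of_add_principalPart_eq_zero hZ hU (L := L)
    (c₀ := (∑ s ∈ U, G s 1 - E₀) x y)
    (c := fun s i => (G s (i + 1) + (Matrix.scalar a s - A) * G s i - B * F s i) x y)
    fun z hz => by
      have hzU : z ∉ U := fun hzU => hU z hzU hz
      have hsum : (∑ s ∈ U, G s 1 - E₀) + principalPart U L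
          (fun s i => G s (i + 1) + (Matrix.scalar a s - A) * G s i - B * F s i) z = 0 := by
        rw [← h z hz, scalar_sub_mul_principalPart A hG hzU, mul_principalPart]
        simp only [principalPart, smul_sub, sum_sub_distrib]
        abel
      rw [← principalPart_apply, ← Matrix.add_apply, hsum, Matrix.zero_apply]
  exact ⟨sub_eq_zero.1 (Matrix.ext fun x y => (hentry x y).1), fun s hs i hi =>
    sub_eq_zero.1 (Matrix.ext fun x y => (hentry x y).2 s hs i hi)⟩

end PrincipalPart

section PolynomialMatrix

open Polynomial

variable {a b c : Type*}

/-- The value at a complex point of a matrix of real polynomials. -/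
noncomputable def evalPoly (M : Matrix a b ℝ[X]) (z : ℂ) : Matrix a b ℂ :=
  M.map (aeval z)

theorem evalPoly_apply (M : Matrix a b ℝ[X]) (z : ℂ) (i : a) (j : b) :
    evalPoly M z i j = aeval z (M i j) := rfl

theorem evalPoly_sub (M N : Matrix a b ℝ[X]) (z : ℂ) :
    evalPoly (M - N) z = evalPoly M z - evalPoly N z :=
  Matrix.map_sub _ (map_sub _) M N

theorem evalPoly_smul (f : ℝ[X]) (M : Matrix a b ℝ[X]) (z : ℂ) :
    evalPoly (f • M) z = aeval z f • evalPoly M z := by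
  ext i j
  simp only [evalPoly_apply, Matrix.smul_apply, smul_eq_mul, map_mul]

theorem evalPoly_mul [Fintype b] (M : Matrix a b ℝ[X]) (N : Matrix b c ℝ[X]) (z : ℂ) :
    evalPoly (M * N) z = evalPoly M z * evalPoly N z :=
  Matrix.map_mul (f := (aeval z : ℝ[X] →ₐ[ℝ] ℂ).toRingHom)

theorem evalPoly_one [DecidableEq a] (z : ℂ) : evalPoly (1 : Matrix a a ℝ[X]) z = 1 :=
  Matrix.map_one _ (map_zero _) (map_one _)

theorem evalPoly_conj (M : Matrix a b ℝ[X]) (z : ℂ) :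
    evalPoly M (starRingEnd ℂ z) = (evalPoly M z).map (starRingEnd ℂ) :=
  Matrix.ext fun _ _ => aeval_conj _ _

theorem inv_smul_evalPoly_conj (f : ℝ[X]) (M : Matrix a b ℝ[X]) (z : ℂ) :
    (aeval (starRingEnd ℂ z) f)⁻¹ • evalPoly M (starRingEnd ℂ z) =
      ((aeval z f)⁻¹ • evalPoly M z).map (starRingEnd ℂ) := by
  ext i j
  simp only [evalPoly_conj, aeval_conj, Matrix.smul_apply, Matrix.map_apply, smul_eq_mul, map_mul,
    map_inv₀]

theorem evalPoly_map_C {k l : ℕ} (M : Matrix (Fin k) (Fin l) ℝ) (z : ℂ) :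
    evalPoly (M.map C) z = cplx M := by
  ext i j
  exact aeval_C z (M i j)

theorem exists_inv_smul_evalPoly_eq_principalPart {f : ℝ[X]} (hf : f.Monic) {M : Matrix a b ℝ[X]}
    (hM : ∀ i j, (M i j).degree < f.degree) : ∃ G : ℂ → ℕ → Matrix a b ℂ,
      (∀ s i, (f.map (algebraMap ℝ ℂ)).rootMultiplicity s < i → G s i = 0) ∧
      ∀ (U : Finset ℂ) (L : ℂ → ℕ), (∀ s, aeval s f = 0 → s ∈ U) →
        (∀ s ∈ U, (f.map (algebraMap ℝ ℂ)).rootMultiplicity s ≤ L s) →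
          ∀ z, aeval z f ≠ 0 → (aeval z f)⁻¹ • evalPoly M z = principalPart U L G z := by
  choose c hc hcz using fun i j => exists_eval_div_eval_eq_principalPart
    (hf.map (algebraMap ℝ ℂ)) (IsAlgClosed.splits _) (g := (M i j).map (algebraMap ℝ ℂ))
    (by simpa only [degree_map] using hM i j)
  simp only [eval_map_algebraMap] at hcz
  refine ⟨fun s k => Matrix.of fun i j => c i j s k, fun s k hk => Matrix.ext fun i j =>
    hc i j s k hk, fun U L hU hL z hz => Matrix.ext fun i j => ?_⟩
  rw [principalPart_apply, Matrix.smul_apply, evalPoly_apply, smul_eq_mul, ← div_eq_inv_mul]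
  exact hcz i j U L hU hL z hz

theorem rootMultiplicity_map_pos {f : ℝ[X]} (hf : f ≠ 0) {s : ℂ} :
    0 < (f.map (algebraMap ℝ ℂ)).rootMultiplicity s ↔ aeval s f = 0 := by
  rw [rootMultiplicity_pos (Polynomial.map_ne_zero hf), IsRoot.def, eval_map_algebraMap]

end PolynomialMatrix

theorem infinite_one_lt_norm_diff (U : Finset ℂ) : ({z : ℂ | 1 < ‖z‖} \ U).Infinite := by
  refine Set.Infinite.sdiff (Set.infinite_of_injective_forall_mem
    (f := fun k : ℕ => ((k + 2 : ℕ) : ℂ)) (fun k l hkl => by simpa using hkl) fun k => ?_)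
    U.finite_toSet
  rw [Set.mem_ofPred_eq, Complex.norm_natCast]
  exact_mod_cast (by lia : 1 < k + 2)

/-- The coefficients of the simple pole approximation whose input response has the principal parts
`F` and whose state response has the principal parts `G`. -/
def SPACoeffs.ofPrincipalParts {n p : ℕ} (F : ℂ → ℕ → Matrix (Fin p) (Fin n) ℂ)
    (G : ℂ → ℕ → Matrix (Fin n) (Fin n) ℂ) : SPACoeffs n p :=
  ⟨fun s => F s 1, fun s => G s 1, G⟩

namespace ControlProblem

open Polynomial

variable {n p q m : ℕ} (S : ControlProblem n p q m)

theorem evalPoly_charmatrix (z : ℂ) : evalPoly S.A.charmatrix z = S.shift z := by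
  ext i j
  by_cases h : i = j <;>
    simp [evalPoly_apply, shift, cplx, Matrix.diagonal, h]

theorem mem_plantPoles {s : ℂ} : s ∈ S.plantPoles ↔ S.mult s ≠ 0 := by
  rw [plantPoles, Multiset.mem_toFinset, mult, ← count_roots, Multiset.count_ne_zero]

variable {S} {P : Finset ℂ}

theorem mtilde_le_one (s : ℂ) : mtilde P s ≤ 1 := by
  rw [mtilde]
  split_ifs <;> norm_num

theorem mem_of_mtilde_ne_zero {s : ℂ} (hs : mtilde P s ≠ 0) : s ∈ P := by
  by_contra hsP
  exact hs (if_neg hsP)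

variable {F : ℂ → ℕ → Matrix (Fin p) (Fin n) ℂ}
  {G : ℂ → ℕ → Matrix (Fin n) (Fin n) ℂ}

theorem spaU_ofPrincipalParts (z : ℂ) :
    spaU P (.ofPrincipalParts F G) z = principalPart P (fun _ => 1) F z := by
  simp only [spaU, SPACoeffs.ofPrincipalParts, principalPart, Finset.Icc_self,
    Finset.sum_singleton, pow_one]

theorem spaX_ofPrincipalParts (z : ℂ) : S.spaX P (.ofPrincipalParts F G) z =
    principalPart (P ∪ S.plantPoles) (fun s => S.mult s + 1) G z := by
  rw [principalPart, ← Finset.sdiff_union_self_eq_union, Finset.sum_union Finset.sdiff_disjoint,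
    spaX]
  refine congrArg (· + _) (Finset.sum_congr rfl fun s hs => ?_)
  rw [not_not.1 (mt S.mem_plantPoles.2 (Finset.mem_sdiff.1 hs).2), zero_add, Finset.Icc_self,
    Finset.sum_singleton, pow_one]
  rfl

theorem spaFeasible_ofPrincipalParts (hF : ∀ s i, mtilde P s < i → F s i = 0)
    (hG : ∀ s i, S.mult s + mtilde P s < i → G s i = 0)
    (hsum : ∑ s ∈ P ∪ S.plantPoles, G s 1 = 1)
    (hrec : ∀ s ∈ P ∪ S.plantPoles, ∀ i ∈ Finset.Icc 1 (S.mult s + 1),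
      G s (i + 1) + S.shift s * G s i = cplx S.B * F s i)
    (hstable : ∀ s ∈ S.plantPoles, 1 ≤ ‖s‖ → ∀ i ∈ Finset.Icc 1 (S.mult s + 1), G s i = 0)
    (hrealU : ∀ z : ℂ, 1 < ‖z‖ → spaU P (.ofPrincipalParts F G) (starRingEnd ℂ z) =
      (spaU P (.ofPrincipalParts F G) z).map (starRingEnd ℂ))
    (hrealX : ∀ z : ℂ, 1 < ‖z‖ → S.spaX P (.ofPrincipalParts F G) (starRingEnd ℂ z) =
      (S.spaX P (.ofPrincipalParts F G) z).map (starRingEnd ℂ)) :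
    S.SPAFeasible P (.ofPrincipalParts F G) where
  sls_common s hs := sub_eq_zero.2 <|
    hrec s (Finset.mem_union_left _ (Finset.mem_inter.1 hs).2) 1 (Finset.mem_Icc.2 ⟨le_rfl, by lia⟩)
  sls_simple s hs := by
    obtain ⟨hsP, hsσ⟩ := Finset.mem_sdiff.1 hs
    have hrec1 := hrec s (Finset.mem_union_left _ hsP) 1 (Finset.mem_Icc.2 ⟨le_rfl, by lia⟩)
    have hmult : S.mult s + mtilde P s < 2 := by
      rw [not_not.1 (mt S.mem_plantPoles.2 hsσ), mtilde, if_pos hsP]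
      norm_num
    rw [hG s 2 hmult, zero_add] at hrec1
    exact sub_eq_zero.2 hrec1
  sls_chain s hs i hi := by
    obtain ⟨hi, hiL⟩ := Finset.mem_Icc.1 hi
    have hreci := hrec s (Finset.mem_union_right _ hs) i (Finset.mem_Icc.2 ⟨by lia, by lia⟩)
    rwa [hF s i (by lia), Matrix.mul_zero] at hreci
  sls_last s hs := by
    have hs0 := S.mem_plantPoles.1 hs
    have hmtilde := mtilde_le_one (P := P) s
    have hlast := hrec s (Finset.mem_union_right _ hs) (S.mult s + mtilde P s)
      (Finset.mem_Icc.2 ⟨by lia, by lia⟩)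
    rwa [hG s _ (Nat.lt_succ_self _), hF s _ (by lia), zero_add, Matrix.mul_zero] at hlast
  sls_sum := by
    rw [← hsum, ← Finset.sdiff_union_self_eq_union, Finset.sum_union Finset.sdiff_disjoint]
    rfl
  stable := hstable
  real_u := hrealU
  real_x := hrealX

variable (S) in
/-- The pair `Φx = M / (a d)`, `Φu = N / d` is strictly proper and satisfies
`(zI - A) Φx - B Φu = I`. The factor `a` collects the plant poles that occur in `Φx` but not
in `Φu`. -/
structure IsNumerators (a d : ℝ[X]) (M : Matrix (Fin n) (Fin n) ℝ[X])
    (N : Matrix (Fin p) (Fin n) ℝ[X]) : Prop where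
  affine : S.A.charmatrix * M - a • (S.B.map Polynomial.C * N) = (a * d) • 1
  degree_state : ∀ i j, (M i j).degree < (a * d).degree
  degree_input : ∀ i j, (N i j).degree < d.degree

theorem IsNumerators.shift_mul_sub_mul_eq_one {a d : ℝ[X]} {M : Matrix (Fin n) (Fin n) ℝ[X]}
    {N : Matrix (Fin p) (Fin n) ℝ[X]} (h : S.IsNumerators a d M N) {z : ℂ}
    (hz : aeval z (a * d) ≠ 0) :
    S.shift z * ((aeval z (a * d))⁻¹ • evalPoly M z) -
      cplx S.B * ((aeval z d)⁻¹ • evalPoly N z) = 1 := by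
  have haffine := congrArg (evalPoly · z) h.affine
  simp only [evalPoly_sub, evalPoly_mul, evalPoly_smul, evalPoly_one, evalPoly_map_C,
    evalPoly_charmatrix] at haffine
  have ha : aeval z a ≠ 0 := left_ne_zero_of_mul (map_mul (aeval z) a d ▸ hz)
  have hinv : (aeval z d)⁻¹ = (aeval z (a * d))⁻¹ * aeval z a := by
    rw [map_mul, mul_inv, mul_right_comm, inv_mul_cancel₀ ha, one_mul]
  rw [hinv, Matrix.mul_smul, Matrix.mul_smul, ← smul_smul, ← smul_sub, haffine, smul_smul,
    inv_mul_cancel₀ hz, one_smul]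

theorem rootMultiplicity_le_mtilde {d : ℝ[X]}
    (hdP : d.map (algebraMap ℝ ℂ) ∣ ∏ s ∈ P, (X - Polynomial.C s)) (s : ℂ) :
    (d.map (algebraMap ℝ ℂ)).rootMultiplicity s ≤ mtilde P s := by
  refine (rootMultiplicity_le_rootMultiplicity_of_dvd
    (Finset.prod_ne_zero_iff.2 fun s _ => X_sub_C_ne_zero s) hdP s).trans ?_
  rw [← count_roots, roots_prod_X_sub_C, mtilde]
  split_ifs with hs
  · exact Multiset.nodup_iff_count_le_one.1 P.nodup s
  · rw [Multiset.count_eq_zero_of_notMem hs]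

theorem rootMultiplicity_le_mult {a : ℝ[X]} (ha : a ∣ S.A.charpoly) (s : ℂ) :
    (a.map (algebraMap ℝ ℂ)).rootMultiplicity s ≤ S.mult s := by
  rw [mult, show (cplx S.A).charpoly = _ from Matrix.charpoly_map S.A (algebraMap ℝ ℂ)]
  exact rootMultiplicity_le_rootMultiplicity_of_dvd ((Matrix.charpoly_monic _).map _).ne_zero
    (Polynomial.map_dvd _ ha) s

section SPACoeffs

variable {a d : ℝ[X]} {M : Matrix (Fin n) (Fin n) ℝ[X]} {N : Matrix (Fin p) (Fin n) ℝ[X]}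

theorem aeval_mul_ne_zero (hP : ∀ s ∈ P, ‖s‖ < 1) (hd : d.Monic)
    (hstable : ∀ s : ℂ, aeval s a = 0 → ‖s‖ < 1)
    (hdP : d.map (algebraMap ℝ ℂ) ∣ ∏ s ∈ P, (X - Polynomial.C s)) {z : ℂ} (hz : 1 ≤ ‖z‖) :
    aeval z (a * d) ≠ 0 := by
  have hzd (hzd : aeval z d = 0) : z ∈ P := mem_of_mtilde_ne_zero
    (((rootMultiplicity_map_pos hd.ne_zero).2 hzd).trans_le (rootMultiplicity_le_mtilde hdP z)).ne'
  rw [map_mul]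
  exact mul_ne_zero (fun hza => (hstable z hza).not_ge hz) fun h => (hP z (hzd h)).not_ge hz

theorem IsNumerators.exists_principalParts (hP : ∀ s ∈ P, ‖s‖ < 1) (ha : a.Monic)
    (hd : d.Monic) (haχ : a ∣ S.A.charpoly) (hstable : ∀ s : ℂ, aeval s a = 0 → ‖s‖ < 1)
    (hdP : d.map (algebraMap ℝ ℂ) ∣ ∏ s ∈ P, (X - Polynomial.C s)) (h : S.IsNumerators a d M N) :
    ∃ (F : ℂ → ℕ → Matrix (Fin p) (Fin n) ℂ) (G : ℂ → ℕ → Matrix (Fin n) (Fin n) ℂ),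
      (∀ s i, mtilde P s < i → F s i = 0) ∧ (∀ s i, S.mult s + mtilde P s < i → G s i = 0) ∧
      (∀ s, 1 ≤ ‖s‖ → ∀ i, 0 < i → G s i = 0) ∧
      (∀ (U : Finset ℂ) (L : ℂ → ℕ), P ⊆ U → (∀ s, 1 ≤ L s) → ∀ z, 1 < ‖z‖ →
        (aeval z d)⁻¹ • evalPoly N z = principalPart U L F z) ∧
      ∀ z, 1 < ‖z‖ → (aeval z (a * d))⁻¹ • evalPoly M z =
        principalPart (P ∪ S.plantPoles) (fun s => S.mult s + 1) G z := by
  obtain ⟨G, hG, hGz⟩ := exists_inv_smul_evalPoly_eq_principalPart (ha.mul hd) h.degree_state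
  obtain ⟨F, hF, hFz⟩ := exists_inv_smul_evalPoly_eq_principalPart hd h.degree_input
  have hdmult := rootMultiplicity_le_mtilde hdP
  have hmult (s : ℂ) :
      ((a * d).map (algebraMap ℝ ℂ)).rootMultiplicity s ≤ S.mult s + mtilde P s := by
    have had : (a * d).map (algebraMap ℝ ℂ) ≠ 0 := ((ha.mul hd).map _).ne_zero
    rw [Polynomial.map_mul] at had ⊢
    rw [rootMultiplicity_mul had]
    exact add_le_add (rootMultiplicity_le_mult haχ s) (hdmult s)
  have hdroot (s : ℂ) (hs : aeval s d = 0) : s ∈ P :=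
    mem_of_mtilde_ne_zero (((rootMultiplicity_map_pos hd.ne_zero).2 hs).trans_le (hdmult s)).ne'
  have hroot (s : ℂ) (hs : aeval s (a * d) = 0) : s ∈ P ∪ S.plantPoles := by
    have hpos := ((rootMultiplicity_map_pos (ha.mul hd).ne_zero).2 hs).trans_le (hmult s)
    rw [Finset.mem_union, S.mem_plantPoles, or_iff_not_imp_right, not_not]
    exact fun hs0 => mem_of_mtilde_ne_zero (by lia)
  have hne (z : ℂ) (hz : 1 ≤ ‖z‖) : aeval z (a * d) ≠ 0 := aeval_mul_ne_zero hP hd hstable hdP hz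
  refine ⟨F, G, fun s i hi => hF s i ((hdmult s).trans_lt hi),
    fun s i hi => hG s i ((hmult s).trans_lt hi), fun s hs i hi => hG s i ?_,
    fun U L hPU hL z hz => hFz U L (fun s hs => hPU (hdroot s hs))
      (fun s _ => (hdmult s).trans ((mtilde_le_one s).trans (hL s))) z
      (right_ne_zero_of_mul (map_mul (aeval z) a d ▸ hne z hz.le)),
    fun z hz => hGz _ _ hroot (fun s _ => (hmult s).trans (Nat.add_le_add_left (mtilde_le_one s) _))
      z (hne z hz.le)⟩
  rwa [Nat.eq_zero_of_not_pos (mt (rootMultiplicity_map_pos (ha.mul hd).ne_zero).1 (hne s hs))]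

theorem IsNumerators.exists_spaCoeffs (hP : ∀ s ∈ P, ‖s‖ < 1) (ha : a.Monic)
    (hd : d.Monic) (haχ : a ∣ S.A.charpoly) (hstable : ∀ s : ℂ, aeval s a = 0 → ‖s‖ < 1)
    (hdP : d.map (algebraMap ℝ ℂ) ∣ ∏ s ∈ P, (X - Polynomial.C s)) (h : S.IsNumerators a d M N) :
    ∃ c : SPACoeffs n p, S.SPAFeasible P c ∧ ∀ z : ℂ, 1 < ‖z‖ →
      S.spaX P c z = (aeval z (a * d))⁻¹ • evalPoly M z ∧
      spaU P c z = (aeval z d)⁻¹ • evalPoly N z := by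
  obtain ⟨F, G, hF, hG, hGstable, hu, hx⟩ := h.exists_principalParts hP ha hd haχ hstable hdP
  have hspaX (z : ℂ) (hz : 1 < ‖z‖) :
      S.spaX P (.ofPrincipalParts F G) z = (aeval z (a * d))⁻¹ • evalPoly M z :=
    (spaX_ofPrincipalParts z).trans (hx z hz).symm
  have hspaU (z : ℂ) (hz : 1 < ‖z‖) :
      spaU P (.ofPrincipalParts F G) z = (aeval z d)⁻¹ • evalPoly N z :=
    (spaU_ofPrincipalParts z).trans (hu P (fun _ => 1) subset_rfl (fun _ => le_rfl) z hz).symm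
  have hlast (s : ℂ) : S.mult s + mtilde P s < S.mult s + 1 + 1 :=
    Nat.lt_succ_of_le (Nat.add_le_add_left (mtilde_le_one s) _)
  obtain ⟨hsum, hrec⟩ := coeff_eq_of_scalar_sub_mul_principalPart_sub_eq (A := cplx S.A)
    (B := cplx S.B) (E₀ := 1) (F := F) (infinite_one_lt_norm_diff (P ∪ S.plantPoles))
    (fun s hs hsZ => hsZ.2 hs) (fun s _ => hG s _ (hlast s)) fun z hz => by
      rw [← hx z hz.1, ← hu _ (fun s => S.mult s + 1) Finset.subset_union_left
        (fun s => Nat.le_add_left 1 _) z hz.1]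
      exact h.shift_mul_sub_mul_eq_one (aeval_mul_ne_zero hP hd hstable hdP hz.1.le)
  refine ⟨.ofPrincipalParts F G, spaFeasible_ofPrincipalParts hF hG hsum hrec
    (fun s _ hs i hi => hGstable s hs i (Finset.mem_Icc.1 hi).1) (fun z hz => ?_) fun z hz => ?_,
    fun z hz => ⟨hspaX z hz, hspaU z hz⟩⟩
  · rw [hspaU z hz, hspaU _ (by rwa [RCLike.norm_conj]), inv_smul_evalPoly_conj]
  · rw [hspaX z hz, hspaX _ (by rwa [RCLike.norm_conj]), inv_smul_evalPoly_conj]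

end SPACoeffs

end ControlProblem

section Numerators

open Polynomial

theorem exists_eq_mul_dvd_pow_isCoprime {R : Type*} [CommRing R] [IsDomain R]
    [IsPrincipalIdealRing R] {a : R} (ha : a ≠ 0) (d : R) :
    ∃ a₁ a₂, a = a₁ * a₂ ∧ (∃ k : ℕ, a₁ ∣ d ^ k) ∧ IsCoprime a₂ d := by
  induction a using UniqueFactorizationMonoid.induction_on_prime with
  | h₁ => exact absurd rfl ha
  | h₂ a hunit =>
    exact ⟨1, a, (one_mul a).symm, ⟨0, one_dvd _⟩,
      isCoprime_one_left.of_isCoprime_of_dvd_left hunit.dvd⟩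
  | h₃ a π _ hπ ih =>
    obtain ⟨a₁, a₂, rfl, ⟨k, hk⟩, hcop⟩ := ih (right_ne_zero_of_mul ha)
    by_cases hπd : π ∣ d
    · exact ⟨π * a₁, a₂, (mul_assoc _ _ _).symm, ⟨k + 1, pow_succ' d k ▸ mul_dvd_mul hπd hk⟩, hcop⟩
    · exact ⟨a₁, π * a₂, mul_left_comm _ _ _, ⟨k, hk⟩,
        (hπ.irreducible.coprime_iff_not_dvd.2 hπd).mul_left hcop⟩

theorem exists_monic_eq_mul_dvd_pow_isCoprime {K : Type*} [Field K] {a : K[X]} (ha : a.Monic)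
    (d : K[X]) : ∃ a₁ a₂ : K[X], a₁.Monic ∧ a₂.Monic ∧ a = a₁ * a₂ ∧ (∃ k : ℕ, a₁ ∣ d ^ k) ∧
      IsCoprime a₂ d := by
  classical
  obtain ⟨a₁, a₂, rfl, ⟨k, hk⟩, hcop⟩ := exists_eq_mul_dvd_pow_isCoprime ha.ne_zero d
  refine ⟨normalize a₁, normalize a₂, monic_normalize (left_ne_zero_of_mul ha.ne_zero),
    monic_normalize (right_ne_zero_of_mul ha.ne_zero), ?_, ⟨k, normalize_dvd_iff.2 hk⟩,
    hcop.of_isCoprime_of_dvd_left (normalize_dvd_iff.2 dvd_rfl)⟩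
  exact ha.normalize_eq_self.symm.trans (normalize_mul _ _)

theorem eq_sum_C_coeff_mul_X_pow {R : Type*} [Semiring R] {f : R[X]} {k : ℕ} (hf : f.degree < k) :
    f = ∑ t : Fin k, C (f.coeff t) * X ^ (t : ℕ) := by
  rcases eq_or_ne f 0 with rfl | h0
  · simp
  · conv_lhs =>
      rw [as_sum_range_C_mul_X_pow' _ ((natDegree_lt_iff_degree_lt h0).2 hf), Finset.sum_range]

variable {R : Type*} [CommRing R] {a b c : Type*}

theorem degree_map_C_mul_apply_le [Fintype b] (M : Matrix a b R) {N : Matrix b c R[X]} {j : c}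
    {l : WithBot ℕ} (hN : ∀ t, (N t j).degree ≤ l) (i : a) : ((M.map C * N) i j).degree ≤ l := by
  rw [Matrix.mul_apply]
  refine (degree_sum_le _ _).trans (Finset.sup_le fun t _ => ?_)
  rw [Matrix.map_apply, ← smul_eq_C_mul]
  exact (degree_smul_le _ _).trans (hN t)

-- In a column of `Y`, the entry of largest degree has its degree raised by the term `X • Y`.
theorem degree_lt_of_degree_charmatrix_mul_le [Fintype a] [DecidableEq a] (A : Matrix a a R)
    {Y : Matrix a b R[X]} {l : ℕ} (h : ∀ i j, ((A.charmatrix * Y) i j).degree ≤ l) (i : a) (j : b) :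
    (Y i j).degree < l := by
  have := Nonempty.intro i
  obtain ⟨i₀, hmax⟩ := Finite.exists_max fun t => (Y t j).degree
  refine (hmax i).trans_lt ?_
  rcases eq_or_ne (Y i₀ j) 0 with h0 | h0
  · rw [h0, degree_zero]
    exact WithBot.bot_lt_coe l
  have hrow : (A.charmatrix * Y) i₀ j = X * Y i₀ j - (A.map C * Y) i₀ j := by
    rw [Matrix.charmatrix, Matrix.sub_mul, Matrix.sub_apply, Matrix.scalar_apply,
      Matrix.diagonal_mul]
    rfl
  have hlow : ((A.map C * Y) i₀ j).degree < (X * Y i₀ j).degree := by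
    rw [mul_comm X]
    exact (degree_map_C_mul_apply_le A hmax i₀).trans_lt (degree_lt_degree_mul_X h0)
  have hle := h i₀ j
  rw [hrow, degree_sub_eq_left_of_degree_lt hlow, mul_comm] at hle
  exact (degree_lt_degree_mul_X h0).trans_le hle

theorem natDegree_adjugate_charmatrix_mul_le [Fintype a] [DecidableEq a] [Fintype c]
    {A : Matrix a a R} {f₁ f₂ : R[X]} (hχ : A.charpoly = f₁ * f₂) (B : Matrix a c R)
    {F : Matrix c b R[X]} {l : ℕ}
    (hF : ∀ i j, ((f₂ • F) i j).natDegree ≤ l) (i : a) (j : b) :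
    ((A.charmatrix.adjugate * (B.map C * F)) i j).natDegree ≤ f₁.natDegree + l := by
  refine natDegree_le_of_degree_le (degree_lt_of_degree_charmatrix_mul_le A (fun i j => ?_) i j).le
  rw [← Matrix.mul_assoc, Matrix.mul_adjugate, ← Matrix.charpoly, hχ, Matrix.smul_mul,
    Matrix.one_mul, mul_smul, ← Matrix.mul_smul, Matrix.smul_apply, smul_eq_mul, Nat.cast_add]
  exact (degree_mul_le _ _).trans (add_le_add degree_le_natDegree
    (degree_map_C_mul_apply_le B (fun k => degree_le_of_natDegree_le (hF k j)) i))

theorem exists_numerator_correction [Nontrivial R] {d f g : R[X]} (hf : f.Monic)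
    (hcop : IsCoprime f d) (hfd : f.natDegree ≤ d.natDegree) (hg : g.natDegree ≤ d.natDegree)
    {N : Matrix a b R[X]} (hN : ∀ i j, (N i j).natDegree ≤ d.natDegree) :
    ∃ E F : Matrix a b R[X], f • F = d • E - g • N ∧ (∀ i j, (E i j).degree < f.degree) ∧
      ∀ i j, ((f • F) i j).natDegree ≤ 2 * d.natDegree := by
  obtain ⟨u, v, huv⟩ := hcop
  set E : Matrix a b R[X] := Matrix.of fun i j => v * (g * N i j) %ₘ f with hE
  have hEdeg (i : a) (j : b) : (E i j).degree < f.degree := degree_modByMonic_lt _ hf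
  have hEF : f • Matrix.of (fun i j => -(u * (g * N i j) + d * (v * (g * N i j) /ₘ f))) =
      d • E - g • N := Matrix.ext fun i j => by
    have hdiv := modByMonic_add_div (v * (g * N i j)) f
    simp only [hE, Matrix.smul_apply, Matrix.sub_apply, Matrix.of_apply, smul_eq_mul]
    linear_combination -d * hdiv - g * N i j * huv
  refine ⟨E, _, hEF, hEdeg, fun i j => ?_⟩
  have hEd : (E i j).natDegree ≤ d.natDegree :=
    (natDegree_le_natDegree (hEdeg i j).le).trans hfd
  rw [hEF, two_mul, Matrix.sub_apply]
  exact natDegree_sub_le_of_le (natDegree_mul_le_of_le le_rfl hEd)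
    (natDegree_mul_le_of_le hg (hN i j)) |>.trans_eq (max_self _)

theorem exists_linear_numerator_correction [Nontrivial R] {d f : R[X]} (hd : d ≠ 0) (hf : f.Monic)
    (hcop : IsCoprime f d) (hfd : f.natDegree ≤ d.natDegree) {N : Matrix a b R[X]}
    (hN : ∀ i j, (N i j).natDegree ≤ d.natDegree) :
    ∃ F : Fin d.natDegree → Matrix a b R[X],
      (∀ t i j, ((f • F t) i j).natDegree ≤ 2 * d.natDegree) ∧
      ∀ g : R[X], g.degree < d.degree → ∃ E : Matrix a b R[X],
        (∀ i j, (E i j).degree < d.degree) ∧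
          f • ∑ t : Fin d.natDegree, C (g.coeff t) • F t = d • E - g • N := by
  choose E F hF hE hFdeg using fun t : Fin d.natDegree => exists_numerator_correction
    (g := X ^ (t : ℕ)) hf hcop hfd ((natDegree_X_pow _).trans_le t.2.le) hN
  refine ⟨F, hFdeg, fun g hg => ⟨∑ t : Fin d.natDegree, C (g.coeff t) • E t, fun i j => ?_, ?_⟩⟩
  · rw [degree_eq_natDegree hd, ← mem_degreeLT, Matrix.sum_apply]
    refine Submodule.sum_mem _ fun t _ => ?_
    rw [Matrix.smul_apply, smul_eq_mul, ← smul_eq_C_mul]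
    refine Submodule.smul_mem _ _ (mem_degreeLT.2 ((hE t i j).trans_le ?_))
    rw [degree_eq_natDegree hf.ne_zero]
    exact_mod_cast hfd
  · have hgN : g • N = ∑ t : Fin d.natDegree, (C (g.coeff t) * X ^ (t : ℕ)) • N := by
      rw [← Finset.sum_smul, ← eq_sum_C_coeff_mul_X_pow (degree_eq_natDegree hd ▸ hg)]
    simp only [hgN, Finset.smul_sum, ← Finset.sum_sub_distrib]
    refine Finset.sum_congr rfl fun t _ => ?_
    rw [smul_comm, hF]
    module

theorem exists_state_numerator [IsDomain R] [Fintype a] [DecidableEq a] [Fintype b]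
    {Λ : Matrix a a R} {f₁ f₂ d e : R} (hdet : Λ.det = f₁ * f₂) (hf₂ : f₂ ≠ 0)
    (hcop : IsCoprime f₂ d) {B : Matrix a b R} {M : Matrix a a R} {N E F : Matrix b a R}
    (heq : Λ * M - B * N = d • 1) (hF : f₂ • F = d • E - e • N) :
    ∃ M' : Matrix a a R, Λ * M' - f₁ • (B * (N + E)) = (f₁ * (d + e)) • 1 ∧
      d • M' = (f₁ * (d + e)) • M + Λ.adjugate * (B * F) := by
  set Q := (d + e) • 1 + B * (N + E) with hQ
  set W := (f₁ * (d + e)) • M + Λ.adjugate * (B * F) with hW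
  have hcancel {V V' : Matrix a a R} (h : f₂ • V = f₂ • V') : V = V' :=
    Matrix.ext fun i j => mul_left_cancel₀ hf₂ (congrFun (congrFun h i) j)
  have hdQ : d • Q = (d + e) • (Λ * M) + f₂ • (B * F) := by
    have hBF : f₂ • (B * F) = d • (B * E) - e • (B * N) := by
      rw [← Matrix.mul_smul, hF, Matrix.mul_sub, Matrix.mul_smul, Matrix.mul_smul]
    rw [hQ, hBF, sub_eq_iff_eq_add.1 heq, Matrix.mul_add]
    module
  have hadjQ : d • (Λ.adjugate * Q) = f₂ • W := by
    rw [← Matrix.mul_smul, hdQ, Matrix.mul_add, Matrix.mul_smul, Matrix.mul_smul,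
      ← Matrix.mul_assoc, Matrix.adjugate_mul, hdet, Matrix.smul_mul, Matrix.one_mul, hW]
    module
  have hdvd (i j : a) : f₂ ∣ (Λ.adjugate * Q) i j :=
    hcop.dvd_of_dvd_mul_left ⟨W i j, congrFun (congrFun hadjQ i) j⟩
  choose M' hM' using hdvd
  have hM' : Λ.adjugate * Q = f₂ • Matrix.of M' := Matrix.ext hM'
  refine ⟨Matrix.of M', ?_, hcancel ?_⟩
  · have hΛM' : Λ * Matrix.of M' = f₁ • Q := hcancel <| by
      rw [← Matrix.mul_smul, ← hM', ← Matrix.mul_assoc, Matrix.mul_adjugate, hdet, Matrix.smul_mul,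
        Matrix.one_mul, mul_comm, mul_smul]
    rw [hΛM', hQ]
    module
  · rw [smul_comm, ← hM', hadjQ]

end Numerators

section HardyNorms

open MeasureTheory
open scoped Matrix.Norms.L2Operator NNReal

-- `f` and `g` need not be measurable: `∫⁻ g ^ p` is attained by a measurable minorant `h` of
-- `g ^ p`, and `h ^ (1 / p) - e` is a measurable minorant of `f`.
theorem lintegral_rpow_le_add_const {α : Type*} [MeasurableSpace α] {μ : Measure α} {p : ℝ}
    (hp : 1 ≤ p) {f g : α → ℝ≥0∞} {e : ℝ≥0∞} (h : ∀ x, g x ≤ f x + e) :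
    (∫⁻ x, g x ^ p ∂μ) ^ (1 / p) ≤
      (∫⁻ x, f x ^ p ∂μ) ^ (1 / p) + e * μ Set.univ ^ (1 / p) := by
  have hp0 : 0 < p := one_pos.trans_le hp
  have hp' : 0 ≤ 1 / p := one_div_nonneg.2 hp0.le
  obtain ⟨k, hk, hkg, hint⟩ := exists_measurable_le_lintegral_eq μ fun x => g x ^ p
  set u := fun x => k x ^ (1 / p)
  have hu : Measurable u := hk.pow_const _
  have huk (x : α) : k x = u x ^ p := by
    rw [← ENNReal.rpow_mul, one_div_mul_cancel hp0.ne', ENNReal.rpow_one]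
  have huf (x : α) : u x - e ≤ f x := by
    refine tsub_le_iff_right.2 (le_trans ?_ (h x))
    rw [← ENNReal.rpow_le_rpow_iff hp0, ← huk]
    exact hkg x
  calc (∫⁻ x, g x ^ p ∂μ) ^ (1 / p)
      ≤ (∫⁻ x, ((fun y => u y - e) + fun _ => e : α → ℝ≥0∞) x ^ p ∂μ) ^ (1 / p) := by
        rw [hint]
        refine ENNReal.rpow_le_rpow (lintegral_mono fun x => ?_) hp'
        rw [huk]
        exact ENNReal.rpow_le_rpow le_tsub_add hp0.le
    _ ≤ (∫⁻ x, (u x - e) ^ p ∂μ) ^ (1 / p) + (∫⁻ _, e ^ p ∂μ) ^ (1 / p) :=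
        ENNReal.lintegral_Lp_add_le (hu.sub_const e).aemeasurable aemeasurable_const hp
    _ ≤ (∫⁻ x, f x ^ p ∂μ) ^ (1 / p) + e * μ Set.univ ^ (1 / p) := by
        rw [lintegral_const, ENNReal.mul_rpow_of_nonneg _ _ hp', ← ENNReal.rpow_mul,
          mul_one_div_cancel hp0.ne', ENNReal.rpow_one]
        gcongr with x
        exact huf x

variable {a b : ℕ}

theorem frobSq_eq_sum (M : Matrix (Fin a) (Fin b) ℂ) :
    frobSq M = ∑ x : Fin a × Fin b, ‖M x.1 x.2‖ₑ ^ (2 : ℝ) := by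
  simp only [ENNReal.rpow_ofNat, frobSq, Fintype.sum_prod_type]

theorem frobSq_add_rpow_le (M N : Matrix (Fin a) (Fin b) ℂ) :
    frobSq (M + N) ^ (1 / 2 : ℝ) ≤ frobSq M ^ (1 / 2 : ℝ) + frobSq N ^ (1 / 2 : ℝ) := by
  simp only [frobSq_eq_sum]
  refine le_trans ?_ (ENNReal.Lp_add_le _ _ _ one_le_two)
  gcongr
  exact enorm_add_le _ _

theorem norm_apply_le_l2_opNorm (M : Matrix (Fin a) (Fin b) ℂ) (i : Fin a) (j : Fin b) :
    ‖M i j‖ ≤ ‖M‖ := by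
  have h := M.l2_opNorm_mulVec (EuclideanSpace.single j 1)
  rw [PiLp.norm_single, norm_one, mul_one] at h
  refine le_trans (le_of_eq ?_) ((PiLp.norm_apply_le _ i).trans h)
  simp

theorem l2_opENorm_mul_le {a b c : Type*} [Fintype a] [Fintype b] [Fintype c] [DecidableEq b]
    [DecidableEq c] (M : Matrix a b ℂ) (N : Matrix b c ℂ) : ‖M * N‖ₑ ≤ ‖M‖ₑ * ‖N‖ₑ :=
  ENNReal.coe_le_coe.2 (M.l2_opNNNorm_mul N) |>.trans_eq (ENNReal.coe_mul _ _)

theorem frobSq_rpow_le (M : Matrix (Fin a) (Fin b) ℂ) :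
    frobSq M ^ (1 / 2 : ℝ) ≤ (a * b : ℝ≥0∞) ^ (1 / 2 : ℝ) * ‖M‖ₑ := by
  have h : frobSq M ≤ a * b * ‖M‖ₑ ^ (2 : ℝ) := by
    rw [frobSq_eq_sum]
    refine (Finset.sum_le_card_nsmul _ _ (‖M‖ₑ ^ (2 : ℝ)) fun x _ => ?_).trans_eq ?_
    · gcongr
      exact enorm_le_iff_norm_le.2 (norm_apply_le_l2_opNorm M x.1 x.2)
    · simp
  refine (ENNReal.rpow_le_rpow h (by norm_num)).trans_eq ?_
  rw [ENNReal.mul_rpow_of_nonneg _ _ (by norm_num), ← ENNReal.rpow_mul]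
  norm_num

theorem normH2_le_add {T T' : ℂ → Matrix (Fin a) (Fin b) ℂ} {e : ℝ≥0∞}
    (h : ∀ z, 1 < ‖z‖ → frobSq (T' z) ^ (1 / 2 : ℝ) ≤ frobSq (T z) ^ (1 / 2 : ℝ) + e) :
    normH2 T' ≤ normH2 T + e := by
  refine iSup₂_le fun r hr => ?_
  refine le_trans ?_ (add_le_add_left (le_iSup₂ (f := fun (r : ℝ) (_ : 1 < r) =>
    (ENNReal.ofReal (1 / (2 * Real.pi)) * ∫⁻ θ in Set.Ioc (0 : ℝ) (2 * Real.pi),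
      frobSq (T (r * Complex.exp (θ * Complex.I)))) ^ (1 / 2 : ℝ)) r hr) e)
  set c := ENNReal.ofReal (1 / (2 * Real.pi))
  set μ := c • volume.restrict (Set.Ioc (0 : ℝ) (2 * Real.pi)) with hμ
  have hcircle (θ : ℝ) : 1 < ‖(r : ℂ) * Complex.exp (θ * Complex.I)‖ := by
    rw [norm_mul, Complex.norm_exp_ofReal_mul_I, mul_one, Complex.norm_real]
    exact hr.trans_le (Real.le_norm_self r)
  have hμ1 : μ Set.univ = 1 := by
    rw [hμ, Measure.smul_apply, Measure.restrict_apply_univ, Real.volume_Ioc, sub_zero,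
      smul_eq_mul, ← ENNReal.ofReal_mul (by positivity), one_div_mul_cancel (by positivity),
      ENNReal.ofReal_one]
  have hint (V : ℂ → Matrix (Fin a) (Fin b) ℂ) :
      c * ∫⁻ θ in Set.Ioc (0 : ℝ) (2 * Real.pi), frobSq (V (r * Complex.exp (θ * Complex.I))) =
        ∫⁻ θ, (frobSq (V (r * Complex.exp ((θ : ℝ) * Complex.I))) ^ (1 / 2 : ℝ)) ^ (2 : ℝ) ∂μ := by
    rw [hμ, lintegral_smul_measure, smul_eq_mul]
    simp only [← ENNReal.rpow_mul, one_div_mul_cancel (two_ne_zero' ℝ), ENNReal.rpow_one]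
  rw [hint, hint]
  refine (lintegral_rpow_le_add_const one_le_two fun θ => h _ (hcircle θ)).trans_eq ?_
  rw [hμ1, ENNReal.one_rpow, mul_one]

theorem normHinf_le_add {T T' : ℂ → Matrix (Fin a) (Fin b) ℂ} {e : ℝ≥0∞}
    (h : ∀ z, 1 < ‖z‖ → ‖T' z - T z‖ₑ ≤ e) : normHinf T' ≤ normHinf T + e :=
  iSup₂_le fun z hz => calc
    ‖T' z‖ₑ = ‖T z + (T' z - T z)‖ₑ := by rw [add_sub_cancel]
    _ ≤ ‖T z‖ₑ + ‖T' z - T z‖ₑ := enorm_add_le _ _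
    _ ≤ normHinf T + e :=
      add_le_add (le_iSup₂ (f := fun (z : ℂ) (_ : 1 < ‖z‖) => ‖T z‖ₑ) z hz) (h z hz)

theorem exists_mixedNorm_le_add (a b : ℕ) (lam : ℝ≥0∞) :
    ∃ L : ℝ≥0, ∀ (T T' : ℂ → Matrix (Fin a) (Fin b) ℂ) (e : ℝ≥0∞),
      (∀ z, 1 < ‖z‖ → ‖T' z - T z‖ₑ ≤ e) → mixedNorm lam T' ≤ mixedNorm lam T + L * e := by
  by_cases hlam : lam = ⊤
  · refine ⟨1, fun T T' e h => ?_⟩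
    simp only [mixedNorm, if_pos hlam, ENNReal.coe_one, one_mul]
    exact normHinf_le_add h
  lift lam to ℝ≥0 using hlam
  set s : ℝ≥0 := (a * b : ℝ≥0) ^ (1 / 2 : ℝ)
  have hs : (a * b : ℝ≥0∞) ^ (1 / 2 : ℝ) = s := by
    rw [ENNReal.coe_rpow_of_nonneg _ (by norm_num), ENNReal.coe_mul, ENNReal.coe_natCast,
      ENNReal.coe_natCast]
  refine ⟨s + lam, fun T T' e h => ?_⟩
  simp only [mixedNorm, if_neg ENNReal.coe_ne_top]
  have hH2 : normH2 T' ≤ normH2 T + s * e := normH2_le_add fun z hz => calc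
    frobSq (T' z) ^ (1 / 2 : ℝ) = frobSq (T z + (T' z - T z)) ^ (1 / 2 : ℝ) := by
        rw [add_sub_cancel]
    _ ≤ frobSq (T z) ^ (1 / 2 : ℝ) + frobSq (T' z - T z) ^ (1 / 2 : ℝ) := frobSq_add_rpow_le _ _
    _ ≤ frobSq (T z) ^ (1 / 2 : ℝ) + s * e := by
        gcongr
        refine (frobSq_rpow_le _).trans ?_
        rw [hs]
        gcongr
        exact h z hz
  calc normH2 T' + lam * normHinf T'
      ≤ normH2 T + s * e + lam * (normHinf T + e) := by
        gcongr
        exact normHinf_le_add h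
    _ = normH2 T + lam * normHinf T + (s + lam : ℝ≥0) * e := by
        push_cast
        ring

theorem ControlProblem.exists_cost_le_add {n p q m : ℕ} (S : ControlProblem n p q m) :
    ∃ L : ℝ≥0, ∀ (Φx Φx' : ℂ → Matrix (Fin n) (Fin n) ℂ) (Φu Φu' : ℂ → Matrix (Fin p) (Fin n) ℂ)
      (e : ℝ≥0∞), (∀ z, 1 < ‖z‖ → ‖Φx' z - Φx z‖ₑ ≤ e) → (∀ z, 1 < ‖z‖ → ‖Φu' z - Φu z‖ₑ ≤ e) →
        S.cost Φx' Φu' ≤ S.cost Φx Φu + L * e := by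
  obtain ⟨L, hL⟩ := exists_mixedNorm_le_add m q S.lam
  refine ⟨L * (‖cplx S.C‖₊ * ‖cplx S.Bhat‖₊ + ‖cplx S.D‖₊ * ‖cplx S.Bhat‖₊),
    fun Φx Φx' Φu Φu' e hx hu => ?_⟩
  rw [ENNReal.coe_mul, mul_assoc]
  have henorm {k : ℕ} (M : Matrix (Fin m) (Fin k) ℂ) (E : Matrix (Fin k) (Fin n) ℂ)
      (hE : ‖E‖ₑ ≤ e) : ‖M * E * cplx S.Bhat‖ₑ ≤ ‖M‖₊ * ‖cplx S.Bhat‖₊ * e := by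
    calc ‖M * E * cplx S.Bhat‖ₑ ≤ ‖M‖ₑ * ‖E‖ₑ * ‖cplx S.Bhat‖ₑ :=
          (l2_opENorm_mul_le _ _).trans (mul_le_mul_left (l2_opENorm_mul_le M E) _)
      _ ≤ ‖M‖ₑ * e * ‖cplx S.Bhat‖ₑ := by gcongr
      _ = ‖M‖₊ * ‖cplx S.Bhat‖₊ * e := mul_right_comm _ _ _
  refine hL _ _ _ fun z hz => ?_
  calc _ = ‖cplx S.C * (Φx' z - Φx z) * cplx S.Bhat +
          cplx S.D * (Φu' z - Φu z) * cplx S.Bhat‖ₑ := by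
        congr 1
        simp only [Matrix.mul_sub, Matrix.sub_mul]
        abel
    _ ≤ _ := enorm_add_le _ _
    _ ≤ _ := by
        push_cast
        rw [add_mul]
        exact add_le_add (henorm _ _ (hx z hz)) (henorm _ _ (hu z hz))

end HardyNorms

section ExteriorBounds

open Polynomial
open scoped Matrix.Norms.L2Operator

theorem norm_evalPoly_le {a b : ℕ} (W : Matrix (Fin a) (Fin b) ℝ[X]) {k : ℕ}
    (hW : ∀ i j, (W i j).natDegree ≤ k) {z : ℂ} (hz : 1 ≤ ‖z‖) :
    ‖evalPoly W z‖ ≤ (∑ t ∈ Finset.range (k + 1), ‖cplx (W.map fun f => f.coeff t)‖) * ‖z‖ ^ k := by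
  have hsum : evalPoly W z =
      ∑ t ∈ Finset.range (k + 1), z ^ t • cplx (W.map fun f => f.coeff t) := by
    ext i j
    rw [evalPoly_apply, aeval_eq_sum_range' (Nat.lt_succ_of_le (hW i j)), Matrix.sum_apply]
    exact Finset.sum_congr rfl fun t _ => (Algebra.smul_def _ _).trans (mul_comm _ _)
  rw [hsum, Finset.sum_mul]
  refine (norm_sum_le _ _).trans (Finset.sum_le_sum fun t ht => ?_)
  rw [norm_smul, norm_pow, mul_comm]
  gcongr
  exact Nat.lt_succ_iff.1 (Finset.mem_range.1 ht)

theorem pow_natDegree_le_norm_aeval {f : ℝ[X]} (hf : f.Monic) {ρ : ℝ} (hρ : ρ ≤ 1)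
    (hroot : ∀ s : ℂ, aeval s f = 0 → ‖s‖ ≤ ρ) {z : ℂ} (hz : 1 ≤ ‖z‖) :
    ((1 - ρ) * ‖z‖) ^ f.natDegree ≤ ‖aeval z f‖ := by
  have hs := IsAlgClosed.splits (f.map (algebraMap ℝ ℂ))
  rw [← eval_map_algebraMap, hs.eval_eq_prod_roots_of_monic (hf.map _),
    ← natDegree_map (algebraMap ℝ ℂ), hs.natDegree_eq_card_roots, ← Multiset.prod_replicate,
    ← Multiset.map_const']
  refine LE.le.trans_eq ?_ (Multiset.prod_hom _ (normHom (α := ℂ)))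
  rw [Multiset.map_map]
  refine Multiset.prod_map_le_prod_map₀ _ _ (fun s _ => by nlinarith) fun s hs => ?_
  have hsρ : ‖s‖ ≤ ρ := hroot s (by rw [← eval_map_algebraMap]; exact (mem_roots'.1 hs).2)
  calc (1 - ρ) * ‖z‖ ≤ ‖z‖ - ‖s‖ := by nlinarith [norm_nonneg s]
    _ ≤ ‖z - s‖ := norm_sub_norm_le z s

theorem exists_norm_inv_smul_evalPoly_le {a b k : ℕ} {W : Matrix (Fin a) (Fin b) ℝ[X]}
    (hW : ∀ i j, (W i j).natDegree ≤ k) {ρ : ℝ} (hρ : ρ < 1) :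
    ∃ K : ℝ, ∀ f : ℝ[X], f.Monic → f.natDegree = k → (∀ s : ℂ, aeval s f = 0 → ‖s‖ ≤ ρ) →
      ∀ z : ℂ, 1 < ‖z‖ → ‖(aeval z f)⁻¹ • evalPoly W z‖ ≤ K := by
  refine ⟨(∑ t ∈ Finset.range (k + 1), ‖cplx (W.map fun f => f.coeff t)‖) / (1 - ρ) ^ k,
    fun f hf hk hroot z hz => ?_⟩
  have hlow := pow_natDegree_le_norm_aeval hf hρ.le hroot hz.le
  have h1ρ : 0 < 1 - ρ := sub_pos.2 hρ
  have hz0 : 0 < ‖z‖ := one_pos.trans hz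
  have hup := norm_evalPoly_le W hW hz.le
  rw [hk] at hlow
  rw [norm_smul, norm_inv, ← div_eq_inv_mul]
  refine (div_le_div₀ ((norm_nonneg _).trans hup) hup (by positivity) hlow).trans_eq ?_
  rw [mul_pow, mul_div_mul_right _ _ (pow_pos hz0 k).ne']

theorem exists_norm_inv_smul_evalPoly_sum_le {a b k l : ℕ}
    {W : Fin l → Matrix (Fin a) (Fin b) ℝ[X]} (hW : ∀ t i j, (W t i j).natDegree ≤ k) {ρ : ℝ}
    (hρ : ρ < 1) :
    ∃ K : ℝ, ∀ f : ℝ[X], f.Monic → f.natDegree = k → (∀ s : ℂ, aeval s f = 0 → ‖s‖ ≤ ρ) →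
      ∀ (c : Fin l → ℝ) (z : ℂ), 1 < ‖z‖ →
        ‖(aeval z f)⁻¹ • evalPoly (∑ t, C (c t) • W t) z‖ ≤ K * ‖c‖ := by
  choose K hK using fun t => exists_norm_inv_smul_evalPoly_le (hW t) hρ
  refine ⟨∑ t, K t, fun f hf hk hroot c z hz => ?_⟩
  have hsum : evalPoly (∑ t, C (c t) • W t) z = ∑ t, (c t : ℂ) • evalPoly (W t) z := by
    ext i j
    simp [evalPoly_apply, Matrix.sum_apply]
  rw [hsum, Finset.smul_sum, Finset.sum_mul]
  refine (norm_sum_le _ _).trans (Finset.sum_le_sum fun t _ => ?_)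
  rw [smul_comm, norm_smul, Complex.norm_real, mul_comm]
  exact mul_le_mul (hK t f hf hk hroot z hz) (norm_le_pi_norm c t) (norm_nonneg _)
    ((norm_nonneg _).trans (hK t f hf hk hroot z hz))

theorem inv_smul_evalPoly_sub_eq {a b : Type*} {f g : ℝ[X]} {M M' U : Matrix a b ℝ[X]}
    (h : g • M' = f • M + U) {z : ℂ} (hf : aeval z f ≠ 0) (hg : aeval z g ≠ 0) :
    (aeval z f)⁻¹ • evalPoly M' z - (aeval z g)⁻¹ • evalPoly M z =
      (aeval z (f * g))⁻¹ • evalPoly U z := by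
  rw [eq_sub_of_add_eq' h.symm, evalPoly_sub, evalPoly_smul, evalPoly_smul, smul_sub, smul_smul,
    smul_smul, map_mul]
  congr 2 <;> field_simp

end ExteriorBounds

section Perturbation

open Polynomial
open scoped Matrix.Norms.L2Operator

theorem exists_norm_inv_smul_evalPoly_sub_le {ι : Type*} [Fintype ι] {r : ι → ℂ} {ρ : ℝ}
    (hρ : ρ < 1) (hr : ‖r‖ ≤ ρ) {f : ℝ[X]} (hf : f.Monic) (hroot : ∀ s : ℂ, aeval s f = 0 → ‖s‖ ≤ ρ)
    {a b : ℕ} {W : Fin (conjProd r).natDegree → Matrix (Fin a) (Fin b) ℝ[X]}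
    (hW : ∀ t i j, (W t i j).natDegree ≤ f.natDegree + 2 * (conjProd r).natDegree) :
    ∃ K : ℝ, ∀ (w : ι → ℂ) (M M' : Matrix (Fin a) (Fin b) ℝ[X]), ‖w‖ ≤ ρ →
      conjProd r • M' = (f * conjProd w) • M +
        ∑ t : Fin (conjProd r).natDegree, C ((conjProd w - conjProd r).coeff t) • W t →
      ∀ z : ℂ, 1 < ‖z‖ → ‖(aeval z (f * conjProd w))⁻¹ • evalPoly M' z -
        (aeval z (conjProd r))⁻¹ • evalPoly M z‖ ≤ K * ‖w - r‖ := by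
  obtain ⟨L, hL⟩ := exists_lipschitzOnWith_coeff_conjProd ι ρ (conjProd r).natDegree
  obtain ⟨K, hK⟩ := exists_norm_inv_smul_evalPoly_sum_le hW hρ
  refine ⟨|K| * L, fun w M M' hw hM' z hz => ?_⟩
  have hfw := hf.mul (monic_conjProd w)
  have hroot_fwr (s : ℂ) (hs : aeval s (f * conjProd w * conjProd r) = 0) : ‖s‖ ≤ ρ := by
    simp only [map_mul, mul_eq_zero] at hs
    rcases hs with (hs | hs) | hs
    exacts [hroot s hs, (norm_le_of_aeval_conjProd_eq_zero hs).trans hw,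
      (norm_le_of_aeval_conjProd_eq_zero hs).trans hr]
  have hne : aeval z (f * conjProd w * conjProd r) ≠ 0 := fun h0 =>
    ((hroot_fwr z h0).trans_lt hρ).not_gt hz
  rw [map_mul] at hne
  have hnatDegree : (f * conjProd w * conjProd r).natDegree =
      f.natDegree + 2 * (conjProd r).natDegree := by
    rw [hfw.natDegree_mul (monic_conjProd r), hf.natDegree_mul (monic_conjProd w),
      natDegree_conjProd w, natDegree_conjProd r]
    ring
  rw [inv_smul_evalPoly_sub_eq hM' (left_ne_zero_of_mul hne) (right_ne_zero_of_mul hne)]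
  refine (hK _ (hfw.mul (monic_conjProd r)) hnatDegree hroot_fwr _ z hz).trans ?_
  rw [mul_assoc]
  gcongr
  · exact le_abs_self K
  · simp only [coeff_sub]
    exact hL.norm_sub_le (mem_closedBall_zero_iff.2 hw) (mem_closedBall_zero_iff.2 hr)

end Perturbation

namespace ControlProblem

open Polynomial
open scoped Matrix.Norms.L2Operator

variable {n p q m : ℕ} {S : ControlProblem n p q m} {M : Matrix (Fin n) (Fin n) ℝ[X]}
  {N : Matrix (Fin p) (Fin n) ℝ[X]}

theorem IsNumerators.exists_of_correction {d e a₁ a₂ : ℝ[X]} {E F : Matrix (Fin p) (Fin n) ℝ[X]}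
    (h : S.IsNumerators 1 d M N) (ha₁ : a₁ ≠ 0) (ha₂ : a₂ ≠ 0) (hd : d ≠ 0)
    (hχ : S.A.charpoly = a₁ * a₂) (hcop : IsCoprime a₂ d) (he : e.degree < d.degree)
    (hE : ∀ i j, (E i j).degree < d.degree) (hF : a₂ • F = d • E - e • N) :
    ∃ M', S.IsNumerators a₁ (d + e) M' (N + E) ∧
      d • M' = (a₁ * (d + e)) • M + S.A.charmatrix.adjugate * (S.B.map Polynomial.C * F) := by
  have haffine := h.affine
  rw [one_smul, one_mul] at haffine
  obtain ⟨M', hM', hdM'⟩ := exists_state_numerator hχ ha₂ hcop haffine hF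
  have hde : (d + e).degree = d.degree := degree_add_eq_left_of_degree_lt he
  have hdN (i : Fin p) (j : Fin n) : ((N + E) i j).degree < (d + e).degree :=
    hde ▸ (degree_add_le _ _).trans_lt (max_lt (h.degree_input i j) (hE i j))
  have hde0 : d + e ≠ 0 := by rwa [Ne, ← degree_eq_bot, hde, degree_eq_bot]
  refine ⟨M', ⟨hM', ?_, hdN⟩, hdM'⟩
  rw [degree_eq_natDegree (mul_ne_zero ha₁ hde0)]
  refine degree_lt_of_degree_charmatrix_mul_le S.A fun i j => ?_
  rw [← degree_eq_natDegree (mul_ne_zero ha₁ hde0), eq_add_of_sub_eq hM', Matrix.add_apply]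
  refine (degree_add_le _ _).trans (max_le ?_ ?_)
  · rw [Matrix.smul_apply, smul_eq_mul, Matrix.one_apply, mul_ite, mul_one, mul_zero]
    split_ifs
    exacts [le_rfl, degree_zero.trans_le bot_le]
  · rw [Matrix.smul_apply, smul_eq_mul, degree_mul, degree_mul]
    gcongr
    exact degree_map_C_mul_apply_le S.B (fun t => (hdN t j).le) i

theorem IsNumerators.exists_linear_perturbation {d : ℝ[X]} (h : S.IsNumerators 1 d M N)
    (hd : d.Monic) (hnd : n ≤ d.natDegree) :
    ∃ a₁ : ℝ[X], a₁.Monic ∧ a₁ ∣ S.A.charpoly ∧ (∃ k : ℕ, a₁ ∣ d ^ k) ∧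
      ∃ (U : Fin d.natDegree → Matrix (Fin n) (Fin n) ℝ[X])
        (V : Fin d.natDegree → Matrix (Fin p) (Fin n) ℝ[X]),
        (∀ t i j, (U t i j).natDegree ≤ a₁.natDegree + 2 * d.natDegree) ∧
        (∀ t i j, (V t i j).natDegree ≤ 2 * d.natDegree) ∧
        ∀ d' : ℝ[X], (d' - d).degree < d.degree → ∃ M' N', S.IsNumerators a₁ d' M' N' ∧
          d • M' = (a₁ * d') • M + ∑ t : Fin d.natDegree, Polynomial.C ((d' - d).coeff t) • U t ∧
          d • N' = d' • N + ∑ t : Fin d.natDegree, Polynomial.C ((d' - d).coeff t) • V t := by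
  obtain ⟨a₁, a₂, ha₁, ha₂, hχ, hk, hcop⟩ :=
    exists_monic_eq_mul_dvd_pow_isCoprime (Matrix.charpoly_monic S.A) d
  have hdeg : a₁.natDegree + a₂.natDegree = n := by
    rw [← ha₁.natDegree_mul ha₂, ← hχ, Matrix.charpoly_natDegree_eq_dim, Fintype.card_fin]
  obtain ⟨F, hFdeg, hF⟩ := exists_linear_numerator_correction hd.ne_zero ha₂ hcop (by lia)
    fun i j => natDegree_le_natDegree (h.degree_input i j).le
  refine ⟨a₁, ha₁, ⟨a₂, hχ⟩, hk, fun t => S.A.charmatrix.adjugate * (S.B.map Polynomial.C * F t),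
    fun t => a₂ • F t, fun t => natDegree_adjugate_charmatrix_mul_le hχ S.B (hFdeg t), hFdeg,
    fun d' hd' => ?_⟩
  obtain ⟨E, hE, hcorr⟩ := hF _ hd'
  obtain ⟨M', hM', hdM'⟩ :=
    h.exists_of_correction ha₁.ne_zero ha₂.ne_zero hd.ne_zero hχ hcop hd' hE hcorr
  rw [add_sub_cancel] at hM' hdM'
  refine ⟨M', _, hM', ?_, ?_⟩
  · rw [hdM']
    simp only [Matrix.mul_sum, Matrix.mul_smul]
  · simp only [smul_comm _ a₂, ← Finset.smul_sum, hcorr]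
    module

theorem IsNumerators.exists_perturbation {ι : Type*} [Fintype ι] {r : ι → ℂ} {ρ : ℝ} (hρ : ρ < 1)
    (hr : ‖r‖ ≤ ρ) (hn : n ≤ (conjProd r).natDegree) (h : S.IsNumerators 1 (conjProd r) M N) :
    ∃ a₁ : ℝ[X], a₁.Monic ∧ a₁ ∣ S.A.charpoly ∧ (∀ s : ℂ, aeval s a₁ = 0 → ‖s‖ < 1) ∧
      ∃ K : ℝ, ∀ w : ι → ℂ, ‖w‖ ≤ ρ → ∃ M' N', S.IsNumerators a₁ (conjProd w) M' N' ∧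
        ∀ z : ℂ, 1 < ‖z‖ →
          ‖(aeval z (a₁ * conjProd w))⁻¹ • evalPoly M' z -
            (aeval z (conjProd r))⁻¹ • evalPoly M z‖ ≤ K * ‖w - r‖ ∧
          ‖(aeval z (conjProd w))⁻¹ • evalPoly N' z -
            (aeval z (conjProd r))⁻¹ • evalPoly N z‖ ≤ K * ‖w - r‖ := by
  obtain ⟨a₁, ha₁, haχ, ⟨k, hk⟩, U, V, hU, hV, hpert⟩ :=
    h.exists_linear_perturbation (monic_conjProd r) hn
  have hroot (s : ℂ) (hs : aeval s a₁ = 0) : ‖s‖ ≤ ρ := by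
    refine (norm_le_of_aeval_conjProd_eq_zero (eq_zero_of_pow_eq_zero (n := k) ?_)).trans hr
    rw [← map_pow]
    exact zero_dvd_iff.1 (hs ▸ map_dvd (aeval s) hk)
  obtain ⟨K₁, hK₁⟩ := exists_norm_inv_smul_evalPoly_sub_le hρ hr ha₁ hroot hU
  obtain ⟨K₂, hK₂⟩ := exists_norm_inv_smul_evalPoly_sub_le hρ hr monic_one (by simp)
    (by simpa using hV)
  simp only [one_mul] at hK₂
  refine ⟨a₁, ha₁, haχ, fun s hs => (hroot s hs).trans_lt hρ, max K₁ K₂, fun w hw => ?_⟩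
  obtain ⟨M', N', hnum, hM', hN'⟩ := hpert _ (degree_conjProd_sub_lt w r)
  refine ⟨M', N', hnum, fun z hz => ⟨?_, ?_⟩⟩
  · exact (hK₁ w M M' hw hM' z hz).trans (by gcongr; exact le_max_left _ _)
  · exact (hK₂ w N N' hw hN' z hz).trans (by gcongr; exact le_max_right _ _)

end ControlProblem

section RationalMatrices

open Polynomial

/-- A common denominator of the entries of a rational matrix. -/
noncomputable def commonDenom {a b : ℕ} (Φ : Matrix (Fin a) (Fin b) (RatFunc ℝ)) : ℝ[X] :=
  ∏ i, ∏ j, (Φ i j).denom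

variable {a b : ℕ} {Φ : Matrix (Fin a) (Fin b) (RatFunc ℝ)}

theorem monic_commonDenom : (commonDenom Φ).Monic :=
  monic_prod_of_monic _ _ fun _ _ => monic_prod_of_monic _ _ fun _ _ => RatFunc.monic_denom _

theorem denom_dvd_commonDenom (i : Fin a) (j : Fin b) : (Φ i j).denom ∣ commonDenom Φ :=
  (Finset.dvd_prod_of_mem (fun j => (Φ i j).denom) (Finset.mem_univ j)).trans
    (Finset.dvd_prod_of_mem (fun i => ∏ j, (Φ i j).denom) (Finset.mem_univ i))

theorem IsStrictlyProperStable.norm_lt_one_of_aeval_commonDenom_eq_zero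
    (hΦ : IsStrictlyProperStable Φ) {s : ℂ} (hs : aeval s (commonDenom Φ) = 0) : ‖s‖ < 1 := by
  simp only [commonDenom, map_prod, Finset.prod_eq_zero_iff, Finset.mem_univ, true_and] at hs
  obtain ⟨i, j, hs⟩ := hs
  exact (hΦ i j).2 s hs

theorem IsStrictlyProperStable.exists_numerators (hΦ : IsStrictlyProperStable Φ) {d : ℝ[X]}
    (hd : d ≠ 0) (hdvd : commonDenom Φ ∣ d) :
    ∃ M : Matrix (Fin a) (Fin b) ℝ[X], (∀ i j, (M i j).degree < d.degree) ∧
      (∀ z : ℂ, aeval z d ≠ 0 → evalTF Φ z = (aeval z d)⁻¹ • evalPoly M z) ∧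
      algebraMap ℝ[X] (RatFunc ℝ) d • Φ = M.map (algebraMap ℝ[X] (RatFunc ℝ)) := by
  choose k hk using fun i j => (denom_dvd_commonDenom i j).trans hdvd
  refine ⟨Matrix.of fun i j => (Φ i j).num * k i j, fun i j => ?_,
    fun z hz => Matrix.ext fun i j => ?_, Matrix.ext fun i j => ?_⟩
  · have hk0 : k i j ≠ 0 := right_ne_zero_of_mul (hk i j ▸ hd)
    rw [Matrix.of_apply, hk i j, degree_mul, degree_mul, degree_eq_natDegree hk0]
    exact WithBot.add_lt_add_right (WithBot.natCast_ne_bot _) (hΦ i j).1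
  · rw [hk i j, map_mul] at hz
    rw [evalTF, Matrix.map_apply, RatFunc.eval, Matrix.smul_apply, evalPoly_apply, Matrix.of_apply,
      smul_eq_mul, ← aeval_def, ← aeval_def, hk i j, map_mul, map_mul]
    have := left_ne_zero_of_mul hz
    have := right_ne_zero_of_mul hz
    field_simp
  · have hdenom : algebraMap ℝ[X] (RatFunc ℝ) (Φ i j).denom ≠ 0 :=
      RatFunc.algebraMap_ne_zero (RatFunc.denom_ne_zero _)
    rw [Matrix.smul_apply, smul_eq_mul, Matrix.map_apply, Matrix.of_apply, map_mul, hk i j, map_mul]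
    nth_rewrite 2 [← RatFunc.num_div_denom (Φ i j)]
    field_simp

theorem map_algebraMap_charmatrix (A : Matrix (Fin a) (Fin a) ℝ) :
    A.charmatrix.map (algebraMap ℝ[X] (RatFunc ℝ)) =
      Matrix.scalar (Fin a) (RatFunc.X : RatFunc ℝ) - constTF A := by
  ext i j
  by_cases h : i = j <;>
    simp [constTF, Matrix.diagonal, h]

theorem map_algebraMap_map_C (B : Matrix (Fin a) (Fin b) ℝ) :
    (B.map C).map (algebraMap ℝ[X] (RatFunc ℝ)) = constTF B :=
  Matrix.ext fun _ _ => RatFunc.algebraMap_C _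

end RationalMatrices

namespace ControlProblem

open Polynomial
open scoped Matrix.Norms.L2Operator

variable {n p q m : ℕ} {S : ControlProblem n p q m} {Φx : Matrix (Fin n) (Fin n) (RatFunc ℝ)}
  {Φu : Matrix (Fin p) (Fin n) (RatFunc ℝ)}

theorem Feasible.exists_isNumerators (h : S.Feasible Φx Φu) {d : ℝ[X]} (hd : d ≠ 0)
    (hdx : commonDenom Φx ∣ d) (hdu : commonDenom Φu ∣ d) :
    ∃ M N, S.IsNumerators 1 d M N ∧ ∀ z : ℂ, aeval z d ≠ 0 →
      evalTF Φx z = (aeval z d)⁻¹ • evalPoly M z ∧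
      evalTF Φu z = (aeval z d)⁻¹ • evalPoly N z := by
  obtain ⟨haffine, hx, hu⟩ := h
  obtain ⟨M, hM, hMz, hMΦ⟩ := hx.exists_numerators hd hdx
  obtain ⟨N, hN, hNz, hNΦ⟩ := hu.exists_numerators hd hdu
  refine ⟨M, N, ⟨?_, by rwa [one_mul], hN⟩, fun z hz => ⟨hMz z hz, hNz z hz⟩⟩
  rw [one_smul, one_mul]
  refine Matrix.map_injective (RatFunc.algebraMap_injective ℝ) ?_
  beta_reduce
  rw [Matrix.map_sub _ (map_sub _), Matrix.map_mul, Matrix.map_mul, ← hMΦ, ← hNΦ,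
    map_algebraMap_charmatrix, map_algebraMap_map_C, Matrix.mul_smul, Matrix.mul_smul, ← smul_sub,
    haffine]
  ext i j
  by_cases hij : i = j <;> simp [hij]

theorem Feasible.exists_conjProd_isNumerators (h : S.Feasible Φx Φu) :
    ∃ (ι : Type) (_ : Fintype ι) (r : ι → ℂ) (M : Matrix (Fin n) (Fin n) ℝ[X])
      (N : Matrix (Fin p) (Fin n) ℝ[X]), ‖r‖ < 1 ∧ n ≤ (conjProd r).natDegree ∧
      S.IsNumerators 1 (conjProd r) M N ∧ ∀ z : ℂ, 1 < ‖z‖ →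
        evalTF Φx z = (aeval z (conjProd r))⁻¹ • evalPoly M z ∧
        evalTF Φu z = (aeval z (conjProd r))⁻¹ • evalPoly N z := by
  set d := X ^ n * (commonDenom Φx * commonDenom Φu) with hd
  have hmonic : (commonDenom Φx * commonDenom Φu).Monic := monic_commonDenom.mul monic_commonDenom
  have hdmonic : d.Monic := (monic_X_pow n).mul hmonic
  obtain ⟨r, hr, hrd⟩ := exists_conjProd_eq_mul_self hdmonic
  have hstable (s : ℂ) (hs : aeval s d = 0) : ‖s‖ < 1 := by
    rw [hd, map_mul, map_mul, map_pow, aeval_X, mul_eq_zero, mul_eq_zero] at hs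
    rcases hs with hs | hs | hs
    · rw [eq_zero_of_pow_eq_zero hs, norm_zero]
      exact one_pos
    · exact h.2.1.norm_lt_one_of_aeval_commonDenom_eq_zero hs
    · exact h.2.2.norm_lt_one_of_aeval_commonDenom_eq_zero hs
  have hr1 : ‖r‖ < 1 := (pi_norm_lt_iff one_pos).2 fun i => hstable _ (hr i)
  have hdvd : commonDenom Φx * commonDenom Φu ∣ conjProd r :=
    hrd ▸ (dvd_mul_left _ _).trans (dvd_mul_right d d)
  obtain ⟨M, N, hnum, heval⟩ := h.exists_isNumerators (monic_conjProd r).ne_zero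
    (dvd_of_mul_right_dvd hdvd) (dvd_of_mul_left_dvd hdvd)
  refine ⟨_, inferInstance, r, M, N, hr1, ?_, hnum, fun z hz => heval z fun h0 =>
    ((norm_le_of_aeval_conjProd_eq_zero h0).trans_lt hr1).not_gt hz⟩
  rw [hrd, hdmonic.natDegree_mul hdmonic, hd, (monic_X_pow n).natDegree_mul hmonic,
    natDegree_X_pow]
  lia

-- The error is linear in `‖w - r‖` although the poles of `(Φx, Φu)` may be multiple and may be
-- plant poles.
theorem Feasible.exists_Jspa_le_add (h : S.Feasible Φx Φu) :
    ∃ (ι : Type) (_ : Fintype ι) (r : ι → ℂ), ‖r‖ < 1 ∧ ∀ ρ < 1, ‖r‖ ≤ ρ → ∃ K : ℝ,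
      ∀ (P : Finset ℂ) (w : ι → ℂ), (∀ s ∈ P, ‖s‖ < 1) → ‖w‖ ≤ ρ →
        (conjProd w).map (algebraMap ℝ ℂ) ∣ ∏ s ∈ P, (X - Polynomial.C s) →
        S.Jspa P ≤ S.cost (evalTF Φx) (evalTF Φu) + ENNReal.ofReal (K * ‖w - r‖) := by
  obtain ⟨ι, _, r, M, N, hr, hn, hnum, heval⟩ := h.exists_conjProd_isNumerators
  refine ⟨ι, _, r, hr, fun ρ hρ hrρ => ?_⟩
  obtain ⟨a, ha, haχ, hstable, K, hK⟩ := hnum.exists_perturbation hρ hrρ hn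
  obtain ⟨L, hL⟩ := S.exists_cost_le_add
  refine ⟨L * K, fun P w hP hw hwP => ?_⟩
  obtain ⟨M', N', hnum', hbound⟩ := hK w hw
  obtain ⟨c, hc, hcz⟩ := hnum'.exists_spaCoeffs hP ha (monic_conjProd w) haχ hstable hwP
  refine (iInf₂_le c hc).trans ((hL (evalTF Φx) (S.spaX P c) (evalTF Φu) (spaU P c)
    (ENNReal.ofReal (K * ‖w - r‖)) (fun z hz => ?_) fun z hz => ?_).trans_eq ?_)
  · rw [(hcz z hz).1, (heval z hz).1, ← ofReal_norm]
    exact ENNReal.ofReal_le_ofReal (hbound z hz).1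
  · rw [(hcz z hz).2, (heval z hz).2, ← ofReal_norm]
    exact ENNReal.ofReal_le_ofReal (hbound z hz).2
  · rw [mul_assoc, ENNReal.ofReal_mul L.coe_nonneg, ENNReal.ofReal_coe_nnreal]

open Filter

theorem Feasible.exists_Jspa_spiralPoles_le_add (h : S.Feasible Φx Φu) :
    ∃ K > 0, ∀ᶠ k : ℕ in atTop, S.Jspa (spiralPoles k) ≤
      S.cost (evalTF Φx) (evalTF Φu) + ENNReal.ofReal (K / √k) := by
  obtain ⟨ι, _, r, hr, hJ⟩ := h.exists_Jspa_le_add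
  obtain ⟨ρ, hrρ, hρ⟩ := exists_between hr
  obtain ⟨K, hK⟩ := hJ ρ hρ hrρ.le
  obtain ⟨K', hspiral⟩ := exists_injective_spiralPole_near ι
  refine ⟨max 1 (|K| * K'), by positivity, ?_⟩
  have hlim : Tendsto (fun k : ℕ => K' / √k) atTop (nhds 0) :=
    (Real.tendsto_sqrt_atTop.comp tendsto_natCast_atTop_atTop).const_div_atTop K'
  filter_upwards [hspiral r hr, hlim.eventually_le_const (sub_pos.2 hrρ), eventually_gt_atTop 0]
    with k ⟨κ, hκ, hκk, hκr⟩ hk hk0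
  have hw : ‖fun i => spiralPole k (κ i)‖ ≤ ρ := by
    linarith [norm_le_norm_add_norm_sub' (fun i => spiralPole k (κ i)) r]
  refine (hK _ _ (fun s hs => norm_lt_one_of_mem_spiralPoles hs) hw
    (map_conjProd_spiralPole_dvd hk0 hκ hκk)).trans ?_
  gcongr
  calc K * ‖(fun i => spiralPole k (κ i)) - r‖
      ≤ |K| * (K' / √k) := mul_le_mul (le_abs_self K) hκr (norm_nonneg _) (abs_nonneg K)
    _ = |K| * K' / √k := (mul_div_assoc _ _ _).symm
    _ ≤ max 1 (|K| * K') / √k := by gcongr; exact le_max_right _ _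

end ControlProblem

theorem corollary1_general {n p q m : ℕ} (S : ControlProblem n p q m)
    (Φx : Matrix (Fin n) (Fin n) (RatFunc ℝ)) (Φu : Matrix (Fin p) (Fin n) (RatFunc ℝ))
    (hopt : S.IsOptimal Φx Φu) (hJpos : 0 < S.Jstar) (hJfin : S.Jstar < ⊤) :
    ∃ K : ℝ, 0 < K ∧ ∃ N : ℕ, 0 < N ∧ ∀ k : ℕ, N ≤ k →
      (spiralPoles k).card + 2 = 2 * k ∧
      S.Jspa (spiralPoles k) < ⊤ ∧
      ((S.Jspa (spiralPoles k)).toReal - S.Jstar.toReal) / S.Jstar.toReal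
        ≤ K / Real.sqrt (k : ℝ) := by
  obtain ⟨hfeas, hcost⟩ := hopt
  obtain ⟨K, hKpos, hK⟩ := hfeas.exists_Jspa_spiralPoles_le_add
  obtain ⟨N, hN⟩ := Filter.eventually_atTop.1 hK
  rw [hcost] at hN
  have hJ : 0 < S.Jstar.toReal := ENNReal.toReal_pos hJpos.ne' hJfin.ne
  refine ⟨K / S.Jstar.toReal, by positivity, N + 1, N.succ_pos, fun k hk => ?_⟩
  have hle := hN k (Nat.le_of_succ_le hk)
  refine ⟨card_spiralPoles_add_two (Nat.zero_lt_of_lt hk),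
    hle.trans_lt (ENNReal.add_lt_top.2 ⟨hJfin, ENNReal.ofReal_lt_top⟩), ?_⟩
  rw [div_right_comm]
  gcongr
  rw [sub_le_iff_le_add', ← ENNReal.toReal_ofReal (show 0 ≤ K / √k by positivity)]
  exact ENNReal.toReal_le_add hle hJfin.ne ENNReal.ofReal_ne_top

theorem corollary1 {n p q m : ℕ} (S : ControlProblem n p q m)
    (hT : ∀ i j, DifferentiableOn ℂ (fun z : ℂ => S.Tdes z i j) {z : ℂ | 1 < ‖z‖})
    (Φx : Matrix (Fin n) (Fin n) (RatFunc ℝ)) (Φu : Matrix (Fin p) (Fin n) (RatFunc ℝ))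
    (hopt : S.IsOptimal Φx Φu)
    (hJpos : 0 < S.Jstar) (hJfin : S.Jstar < ⊤) :
    ∃ K : ℝ, 0 < K ∧ ∃ N : ℕ, 0 < N ∧ ∀ k : ℕ, N ≤ k →
      (spiralPoles k).card + 2 = 2 * k ∧
      S.Jspa (spiralPoles k) < ⊤ ∧
      ((S.Jspa (spiralPoles k)).toReal - S.Jstar.toReal) / S.Jstar.toReal
        ≤ K / Real.sqrt (k : ℝ) :=
  corollary1_general S Φx Φu hopt hJpos hJfin
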